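/- Let $\varphi$ be Abel's lemniscatic function: on $[-\varpi/2,\varpi/2]$, where $\varpi = 2\int_0^1 \frac{dt}{\sqrt{1-t^4}}$, it is the inverse function of $r \mapsto \int_0^r \frac{dt}{\sqrt{1-t^4}}$, $r\in[-1,1]$; it is extended to $\mathbb{R}$ by $\varphi(s+\varpi) = -\varphi(s)$, and to $\mathbb{C}$ (as a meromorphic function) by $$\varphi(x+iy) = \frac{\varphi(x)\varphi'(y) + i\,\varphi(y)\varphi'(x)}{1-\varphi(x)^2\varphi(y)^2}, \qquad x,y\in\mathbb{R}.$$ Let $\mathcal{O} = \mathbb{Z}[i]$. Call $\beta\in\mathcal{O}$ odd if it is relatively prime to $1+i$, and call an odd $\beta$ normalized if $\beta \equiv 1 \bmod 2(1+i)$. For odd $\beta\in\mathcal{O}$ set $\delta_\beta = \frac{(1+i)\varpi}{\beta}$ and define the $\beta$-th lemnatomic polynomial $$\Lambda_\beta(x) = \prod_{[\alpha]\in(\mathcal{O}/\beta\mathcal{O})^\times} \bigl(x-\varphi(\alpha\delta_\beta)\bigr).$$ Let $\beta\in\mathcal{O}$ be odd and a nonunit. If $\beta = u\pi^k$, where $u\in\mathcal{O}^\times$,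 $\pi$ is a normalized prime of $\mathcal{O}$, and $k\ge 1$ is an integer, then $\Lambda_\beta(0) = \pi$. In all other cases, that is, if $\beta$ has no such representation, $\Lambda_\beta(0) = 1$. -/

import Mathlib

namespace Lemnatomic

noncomputable section

/-- Arc length on the lemniscate `r² = cos 2θ`, as a function of the signed polar distance
`r ∈ [-1, 1]`: the integral of `dt / √(1 - t⁴)` from `0` to `r`. -/
def arcLength (r : ℝ) : ℝ := ∫ t in (0 : ℝ)..r, 1 / Real.sqrt (1 - t ^ 4)

/-- The lemniscate constant `ϖ = 2 ∫₀¹ dt / √(1 - t⁴)`. -/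
def varpi : ℝ := 2 * arcLength 1

/-- Abel's lemniscatic function on the real line. On `[-ϖ/2, ϖ/2]` it is the inverse function of
`arcLength : [-1, 1] → [-ϖ/2, ϖ/2]`, and it is extended to `ℝ` by the rule `φ(s + ϖ) = -φ(s)`
(hence with period `2ϖ`). Here `n = round (s / ϖ)` is an integer with `s - nϖ ∈ [-ϖ/2, ϖ/2]`. -/
def realPhi (s : ℝ) : ℝ :=
  (-1 : ℝ) ^ (round (s / varpi)) *
    Function.invFunOn arcLength (Set.Icc (-1) 1) (s - round (s / varpi) * varpi)

/-- Abel's lemniscatic function `φ` on `ℂ`, extended from the real line by `φ(iy) = i φ(y)` and the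
addition law:
`φ(x + iy) = (φ(x) φ'(y) + i φ(y) φ'(x)) / (1 - φ(x)² φ(y)²)`.
At the poles `(m + ni) ϖ / 2`, with `m, n` odd, division by zero gives it the value `0`; no such
point is a `β`-torsion point for an odd `β`. -/
def phi (z : ℂ) : ℂ :=
  ((realPhi z.re : ℂ) * ((deriv realPhi z.im : ℝ) : ℂ)
      + Complex.I * (realPhi z.im : ℂ) * ((deriv realPhi z.re : ℝ) : ℂ))
    / (1 - (realPhi z.re : ℂ) ^ 2 * (realPhi z.im : ℂ) ^ 2)

/-- The Gaussian integer `1 + i`. -/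
def onePlusI : GaussianInt := ⟨1, 1⟩

/-- A Gaussian integer is odd if it is relatively prime to `1 + i`. -/
def IsOdd (β : GaussianInt) : Prop := IsCoprime β onePlusI

/-- An odd Gaussian integer `β` is normalized if `β ≡ 1 mod 2(1 + i)`. -/
def IsNormalized (β : GaussianInt) : Prop := IsOdd β ∧ 2 * onePlusI ∣ β - 1

/-- The torsion generator `δ_β = (1 + i) ϖ / β`. -/
def delta (β : GaussianInt) : ℂ := (onePlusI : ℂ) * (varpi : ℂ) / (β : ℂ)

/-- The division value `φ(α δ_β)` attached to the class `[α]` in `ℤ[i] / β ℤ[i]`, computed with a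
chosen representative `α`; see `divisionValue_mk` for the independence of that choice. -/
def divisionValue (β : GaussianInt) (a : GaussianInt ⧸ Ideal.span {β}) : ℂ :=
  phi (((Quotient.out a : GaussianInt) : ℂ) * delta β)

/-- The `β`-th lemnatomic polynomial: the product of `x - φ(α δ_β)` over the classes `[α]` in
`(ℤ[i] / β ℤ[i])ˣ`, a finite group for `β ≠ 0`. -/
def lemnatomic (β : GaussianInt) : Polynomial ℂ :=
  ∏ᶠ a : (GaussianInt ⧸ Ideal.span {β})ˣ,
    (Polynomial.X - Polynomial.C (divisionValue β (a : GaussianInt ⧸ Ideal.span {β})))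

theorem realPhi_add_int (h : varpi ≠ 0) (n : ℤ) (s : ℝ) :
    realPhi (s + n * varpi) = (-1) ^ n * realPhi s := by
  have e : round ((s + n * varpi) / varpi) = round (s / varpi) + n := by
    rw [add_div, mul_div_cancel_right₀ _ h, round_add_intCast]
  unfold realPhi
  rw [e, zpow_add₀ (by norm_num)]
  push_cast
  have : s + n * varpi - (round (s / varpi) + n) * varpi = s - round (s / varpi) * varpi := by
    ring
  rw [this]; ring

theorem deriv_realPhi_add_int (h : varpi ≠ 0) (n : ℤ) (s : ℝ) :
    deriv realPhi (s + n * varpi) = (-1) ^ n * deriv realPhi s := by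
  rw [← deriv_comp_add_const, funext (realPhi_add_int h n), deriv_const_mul_field]

/-- `φ` is periodic with respect to the lattice `L = ℤ[i] (1 + i) ϖ`. -/
theorem phi_add_lattice (z : ℂ) (g : GaussianInt) :
    phi (z + (g : ℂ) * ((onePlusI : ℂ) * (varpi : ℂ))) = phi z := by
  by_cases h : varpi = 0
  · simp [h]
  have hre : (z + (g : ℂ) * ((onePlusI : ℂ) * (varpi : ℂ))).re
      = z.re + ((g.re - g.im : ℤ) : ℝ) * varpi := by
    simp only [onePlusI, GaussianInt.toComplex_def₂, Complex.add_re, Complex.mul_re,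
      Complex.mul_im, Complex.ofReal_re, Complex.ofReal_im]
    push_cast
    ring
  have him : (z + (g : ℂ) * ((onePlusI : ℂ) * (varpi : ℂ))).im
      = z.im + ((g.re + g.im : ℤ) : ℝ) * varpi := by
    simp only [onePlusI, GaussianInt.toComplex_def₂, Complex.add_im, Complex.mul_re,
      Complex.mul_im, Complex.ofReal_re, Complex.ofReal_im]
    push_cast
    ring
  have hpar : (-1 : ℝ) ^ (g.re + g.im) = (-1) ^ (g.re - g.im) := by
    have : g.re + g.im = (g.re - g.im) + 2 * g.im := by ring
    rw [this, zpow_add₀ (by norm_num), zpow_mul]; norm_num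
  have hsq : ((-1 : ℝ) ^ (g.re - g.im)) ^ 2 = 1 := by
    rcases Int.even_or_odd (g.re - g.im) with h | h
    · simp [h.neg_one_zpow]
    · simp [h.neg_one_zpow]
  unfold phi
  rw [hre, him, realPhi_add_int h, realPhi_add_int h, deriv_realPhi_add_int h,
    deriv_realPhi_add_int h, hpar]
  generalize (-1 : ℝ) ^ (g.re - g.im) = c at hsq
  have hc : (c : ℂ) ^ 2 = 1 := by exact_mod_cast hsq
  push_cast
  congr 1
  · linear_combination ((realPhi z.re : ℂ) * ((deriv realPhi z.im : ℝ) : ℂ)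
      + Complex.I * (realPhi z.im : ℂ) * ((deriv realPhi z.re : ℝ) : ℂ)) * hc
  · linear_combination (-(realPhi z.re : ℂ) ^ 2 * (realPhi z.im : ℂ) ^ 2 * ((c : ℂ) ^ 2 + 1)) * hc

theorem divisionValue_mk {β : GaussianInt} (hβ : β ≠ 0) (α : GaussianInt) :
    divisionValue β (Ideal.Quotient.mk _ α) = phi ((α : ℂ) * delta β) := by
  have h : Ideal.Quotient.mk (Ideal.span {β})
      (Quotient.out (Ideal.Quotient.mk (Ideal.span {β}) α)) = Ideal.Quotient.mk _ α :=
    Quotient.out_eq _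
  rw [Ideal.Quotient.eq, Ideal.mem_span_singleton] at h
  obtain ⟨g, hg⟩ := h
  have hβ' : (β : ℂ) ≠ 0 := by simpa using hβ
  unfold divisionValue
  rw [sub_eq_iff_eq_add'.mp hg, ← phi_add_lattice ((α : ℂ) * delta β) g]
  congr 1
  unfold delta
  rw [map_add, map_mul]
  field_simp

end

end Lemnatomic

namespace Lemnatomic

open Set MeasureTheory Filter Topology

/-! The function `φ` satisfies `φ'² = 1 - φ⁴` on the real line. Its complex extension is meromorphic
and doubly periodic, with simple zeros on `ϖ ℤ[i]` and simple poles on the translate by `(1 + i) ϖ /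
2`. For normalized `β`, the functions `φ(β z)` and `∏ φ(z + α δ_β)`, `α` running over all classes
mod `β`, have the same divisor and common periods, so their quotient is constant by Liouville. At `z
= ϖ/2` multiplication by `i` pairs the factors into mutually inverse values, so the constant is 1
(`phi_mul_eq_prod`).

Comparing derivatives at 0 gives `∏_{α ≠ 0} φ(α δ_β) = β` (`prod_phi_divisionPoint`), which settles
a normalized prime. For composite moduli, the product formula for a normalized `p`, taken at the
points `α δ_{pγ}`, shows that the product of `φ(α δ_{pγ})` over `α` mod `pγ` coprime to `γ` equals
`unitProd γ`. If `p ∣ γ`, that product is `unitProd (p * γ)`. If the prime `p` does not divide the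
nonunit `γ`, the multiples of `p` alone already contribute `unitProd γ ≠ 0`, and the remaining
factor `unitProd (p * γ)` must be 1. Peeling off powers of one prime factor then gives all cases.
Signs cause no trouble, as `φ` is odd and negation permutes the classes. -/

/-! ### Arc length on `[-1, 1]` -/

theorem one_sub_pow_four_pos {t : ℝ} (ht : t ∈ Ioo (-1 : ℝ) 1) : 0 < 1 - t ^ 4 := by
  have h : t ^ 2 < 1 := by nlinarith [ht.1, ht.2]
  nlinarith [sq_nonneg t]

/-- Since `t⁴ ≤ t²`, the integrand is dominated by the derivative of `arcsin`, which is integrable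
as the nonnegative derivative of a continuous function. -/
theorem intervalIntegrable_arcLength :
    IntervalIntegrable (fun t : ℝ => 1 / Real.sqrt (1 - t ^ 4)) volume (-1) 1 := by
  have h1 : IntegrableOn (fun t : ℝ => 1 / Real.sqrt (1 - t ^ 2)) (Ioc (-1) 1) := by
    refine intervalIntegral.integrableOn_deriv_of_nonneg (g := Real.arcsin)
      Real.continuous_arcsin.continuousOn (fun x hx => ?_) (fun x hx => by positivity)
    exact Real.hasDerivAt_arcsin (by linarith [hx.1]) (by linarith [hx.2])
  rw [intervalIntegrable_iff_integrableOn_Ioc_of_le (by norm_num)]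
  refine Integrable.mono' h1
    (by fun_prop : Measurable fun t : ℝ => 1 / Real.sqrt (1 - t ^ 4)).aestronglyMeasurable ?_
  refine (ae_restrict_iff' measurableSet_Ioc).2 (ae_of_all _ fun t ht => ?_)
  rw [Real.norm_of_nonneg (by positivity)]
  -- At `t = 1` both sides are `1 / 0 = 0`.
  rcases eq_or_lt_of_le ht.2 with rfl | h
  · norm_num
  have h2 : t ^ 2 < 1 := by nlinarith [ht.1]
  apply one_div_le_one_div_of_le (Real.sqrt_pos.2 (by linarith))
  apply Real.sqrt_le_sqrt
  nlinarith [sq_nonneg t]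

theorem intervalIntegrable_arcLength_zero {r : ℝ} (hr : r ∈ Icc (-1 : ℝ) 1) :
    IntervalIntegrable (fun t : ℝ => 1 / Real.sqrt (1 - t ^ 4)) volume 0 r := by
  refine intervalIntegrable_arcLength.mono_set ?_
  rw [uIcc_of_le (show (-1 : ℝ) ≤ 1 by norm_num)]
  exact uIcc_subset_Icc (by norm_num) hr

theorem continuousOn_arcLength : ContinuousOn arcLength (Icc (-1) 1) := by
  have := intervalIntegral.continuousOn_primitive_interval' (a := 0) intervalIntegrable_arcLength
    (by rw [uIcc_of_le (by norm_num)]; norm_num)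
  rwa [uIcc_of_le (by norm_num)] at this

theorem hasDerivAt_arcLength {r : ℝ} (hr : r ∈ Ioo (-1 : ℝ) 1) :
    HasDerivAt arcLength (1 / Real.sqrt (1 - r ^ 4)) r := by
  refine intervalIntegral.integral_hasDerivAt_right
    (intervalIntegrable_arcLength_zero (Ioo_subset_Icc_self hr)) ?_ ?_
  · exact (by fun_prop : Measurable fun t : ℝ => 1 / Real.sqrt (1 - t ^ 4)).stronglyMeasurable.stronglyMeasurableAtFilter
  · refine ContinuousAt.div continuousAt_const (by fun_prop) ?_
    exact (Real.sqrt_pos.2 (one_sub_pow_four_pos hr)).ne'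

theorem strictMonoOn_arcLength : StrictMonoOn arcLength (Icc (-1) 1) := by
  refine strictMonoOn_of_deriv_pos (convex_Icc _ _) continuousOn_arcLength fun r hr => ?_
  rw [interior_Icc] at hr
  rw [(hasDerivAt_arcLength hr).deriv]
  exact one_div_pos.2 (Real.sqrt_pos.2 (one_sub_pow_four_pos hr))

theorem arcLength_zero : arcLength 0 = 0 := by simp [arcLength]

theorem arcLength_neg (r : ℝ) : arcLength (-r) = -arcLength r := by
  unfold arcLength
  have := intervalIntegral.integral_comp_neg (a := 0) (b := r)
    (fun t : ℝ => 1 / Real.sqrt (1 - t ^ 4))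
  simp only [Even.neg_pow (show Even 4 by decide), neg_zero] at this
  rw [this, intervalIntegral.integral_symm]

theorem arcLength_one : arcLength 1 = varpi / 2 := by simp [varpi]

theorem varpi_pos : 0 < varpi := by
  have := strictMonoOn_arcLength (a := 0) (by norm_num) (b := 1) (by norm_num) one_pos
  rw [arcLength_zero] at this
  simpa [varpi] using this

theorem bijOn_arcLength : BijOn arcLength (Icc (-1) 1) (Icc (-(varpi / 2)) (varpi / 2)) := by
  refine ⟨fun r hr => ?_, strictMonoOn_arcLength.injOn, ?_⟩
  · rw [← arcLength_one, ← arcLength_neg]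
    exact ⟨strictMonoOn_arcLength.monotoneOn (by norm_num) hr hr.1,
      strictMonoOn_arcLength.monotoneOn hr (by norm_num) hr.2⟩
  · have := intermediate_value_Icc (show (-1 : ℝ) ≤ 1 by norm_num) continuousOn_arcLength
    rwa [arcLength_neg, arcLength_one] at this

/-! ### The real function as inverse of arc length -/

theorem realPhi_add_varpi (s : ℝ) : realPhi (s + varpi) = -realPhi s := by
  simpa using realPhi_add_int varpi_pos.ne' 1 s

theorem exists_int_mem_Ioc (s : ℝ) :
    ∃ (n : ℤ) (t : ℝ), t ∈ Ioc (-(varpi / 2)) (varpi / 2) ∧ s = t + n * varpi := by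
  obtain ⟨n, hn, -⟩ := existsUnique_sub_zsmul_mem_Ioc varpi_pos s (-(varpi / 2))
  refine ⟨n, s - n • varpi, ⟨hn.1, by linarith [hn.2]⟩, by simp⟩

theorem realPhi_eq_invFunOn {s : ℝ} (hs : s ∈ Icc (-(varpi / 2)) (varpi / 2)) :
    realPhi s = Function.invFunOn arcLength (Icc (-1) 1) s := by
  have hv := varpi_pos
  have key : ∀ s ∈ Ico (-(varpi / 2)) (varpi / 2),
      realPhi s = Function.invFunOn arcLength (Icc (-1) 1) s := by
    intro s hs
    have : round (s / varpi) = 0 := by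
      rw [round_eq_zero_iff]
      constructor
      · rw [le_div_iff₀ hv]; linarith [hs.1]
      · rw [div_lt_iff₀ hv]; linarith [hs.2]
    simp [realPhi, this]
  -- `round (1/2) = 1`, so the right endpoint is reached from `-ϖ/2` through the antiperiod.
  rcases eq_or_lt_of_le hs.2 with rfl | h
  · have h1 : varpi / 2 = -(varpi / 2) + varpi := by ring
    have hl := bijOn_arcLength.injOn.leftInvOn_invFunOn
    have e1 := hl (show (1 : ℝ) ∈ Icc (-1 : ℝ) 1 by norm_num)
    have e2 := hl (show (-1 : ℝ) ∈ Icc (-1 : ℝ) 1 by norm_num)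
    rw [arcLength_neg, arcLength_one] at e2
    rw [arcLength_one] at e1
    rw [e1, h1, realPhi_add_varpi, key _ ⟨le_rfl, by linarith⟩, e2, neg_neg]
  · exact key s ⟨hs.1, h⟩

theorem realPhi_mem {s : ℝ} (hs : s ∈ Icc (-(varpi / 2)) (varpi / 2)) :
    realPhi s ∈ Icc (-1 : ℝ) 1 := by
  rw [realPhi_eq_invFunOn hs]
  exact bijOn_arcLength.surjOn.mapsTo_invFunOn hs

theorem arcLength_realPhi {s : ℝ} (hs : s ∈ Icc (-(varpi / 2)) (varpi / 2)) :
    arcLength (realPhi s) = s := by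
  rw [realPhi_eq_invFunOn hs]
  exact bijOn_arcLength.surjOn.rightInvOn_invFunOn hs

theorem realPhi_arcLength {r : ℝ} (hr : r ∈ Icc (-1 : ℝ) 1) : realPhi (arcLength r) = r := by
  rw [realPhi_eq_invFunOn (bijOn_arcLength.mapsTo hr)]
  exact bijOn_arcLength.injOn.leftInvOn_invFunOn hr

theorem realPhi_zero : realPhi 0 = 0 := by
  simpa [arcLength_zero] using realPhi_arcLength (r := 0) (by norm_num)

theorem realPhi_half : realPhi (varpi / 2) = 1 := by
  simpa [arcLength_one] using realPhi_arcLength (r := 1) (by norm_num)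

theorem realPhi_neg (s : ℝ) : realPhi (-s) = -realPhi s := by
  obtain ⟨n, t, ht, rfl⟩ := exists_int_mem_Ioc s
  have ht' : t ∈ Icc (-(varpi / 2)) (varpi / 2) := Ioc_subset_Icc_self ht
  have h : realPhi (-t) = -realPhi t := by
    have hr := realPhi_mem ht'
    have := realPhi_arcLength (r := -realPhi t) ⟨by linarith [hr.2], by linarith [hr.1]⟩
    rwa [arcLength_neg, arcLength_realPhi ht'] at this
  have e : -(t + n * varpi) = -t + ((-n : ℤ) : ℝ) * varpi := by push_cast; ring
  rw [e, realPhi_add_int varpi_pos.ne', realPhi_add_int varpi_pos.ne', h, zpow_neg,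
    ← inv_zpow]
  norm_num

theorem strictMonoOn_realPhi : StrictMonoOn realPhi (Icc (-(varpi / 2)) (varpi / 2)) := by
  intro s hs t ht hst
  rw [← arcLength_realPhi hs, ← arcLength_realPhi ht] at hst
  exact (strictMonoOn_arcLength.lt_iff_lt (realPhi_mem hs) (realPhi_mem ht)).1 hst

theorem image_realPhi : realPhi '' Icc (-(varpi / 2)) (varpi / 2) = Icc (-1) 1 := by
  ext r
  refine ⟨?_, fun hr => ⟨arcLength r, bijOn_arcLength.mapsTo hr, realPhi_arcLength hr⟩⟩
  rintro ⟨s, hs, rfl⟩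
  exact realPhi_mem hs

theorem realPhi_mem_Ioo {s : ℝ} (hs : s ∈ Ioo (-(varpi / 2)) (varpi / 2)) :
    realPhi s ∈ Ioo (-1 : ℝ) 1 := by
  have hv := varpi_pos
  have h1 := strictMonoOn_realPhi (Ioo_subset_Icc_self hs) ⟨by linarith, le_rfl⟩ hs.2
  have h2 := strictMonoOn_realPhi ⟨le_rfl, by linarith⟩ (Ioo_subset_Icc_self hs) hs.1
  rw [realPhi_neg] at h2
  rw [realPhi_half] at h1 h2
  exact ⟨h2, h1⟩

/-! ### Differential equations of the real function -/

theorem hasDerivAt_realPhi_of_mem_Ioo {s : ℝ} (hs : s ∈ Ioo (-(varpi / 2)) (varpi / 2)) :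
    HasDerivAt realPhi (Real.sqrt (1 - realPhi s ^ 4)) s := by
  have hm := realPhi_mem_Ioo hs
  have hc : ContinuousAt realPhi s := by
    refine strictMonoOn_realPhi.continuousAt_of_image_mem_nhds (Icc_mem_nhds hs.1 hs.2) ?_
    rw [image_realPhi]
    exact Icc_mem_nhds hm.1 hm.2
  have hp := Real.sqrt_pos.2 (one_sub_pow_four_pos hm)
  have := HasDerivAt.of_local_left_inverse hc (hasDerivAt_arcLength hm) (one_div_pos.2 hp).ne'
    (by filter_upwards [Ioo_mem_nhds hs.1 hs.2] with t ht
        exact arcLength_realPhi (Ioo_subset_Icc_self ht))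
  simpa using this

/-- Reflection in `a` turns the left derivative `e` into the right derivative `-ε e`, and `hε` makes
the two agree. Both signs are used at `a = ϖ/2`: `ε = 1` for `φ` (with `e = 0`) and `ε = -1` for
`φ'`. -/
theorem hasDerivAt_zero_of_symm {f : ℝ → ℝ} {a ε e : ℝ} (hε : ε * e = -e)
    (hf : ∀ s, f (2 * a - s) = ε * f s) (hε2 : ε * ε = 1)
    (h : HasDerivWithinAt f e (Iic a) a) : HasDerivAt f e a := by
  have h2 : HasDerivWithinAt (fun s => ε * f (2 * a - s)) (ε * (e * (-1))) (Ici a) a := by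
    refine HasDerivWithinAt.const_mul ε ?_
    refine HasDerivWithinAt.comp a (s' := Iic a) (h := fun s => 2 * a - s) ?_ ?_ ?_
    · rwa [show 2 * a - a = a by ring]
    · simpa using ((hasDerivAt_id a).const_sub (2 * a)).hasDerivWithinAt
    · intro s hs
      simp only [mem_Iic, mem_Ici] at *
      linarith
  have e1 : (fun s => ε * f (2 * a - s)) = f := by
    ext s; rw [hf, ← mul_assoc, hε2, one_mul]
  rw [e1] at h2
  have e2 : ε * (e * (-1)) = e := by linarith
  rw [e2] at h2
  have := h.union h2
  rwa [Iic_union_Ici, hasDerivWithinAt_univ] at this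

theorem Ioo_mem_nhdsLT_half : Ioo (-(varpi / 2)) (varpi / 2) ∈ 𝓝[<] (varpi / 2) :=
  Ioo_mem_nhdsLT (by linarith [varpi_pos])

theorem continuousWithinAt_realPhi_half :
    ContinuousWithinAt realPhi (Iic (varpi / 2)) (varpi / 2) := by
  have hv := varpi_pos
  refine strictMonoOn_realPhi.continuousWithinAt_left_of_image_mem_nhdsWithin
    (Icc_mem_nhdsLE (by linarith)) ?_
  rw [image_realPhi, realPhi_half]
  exact Icc_mem_nhdsLE (by norm_num)

theorem realPhi_varpi_sub (s : ℝ) : realPhi (2 * (varpi / 2) - s) = realPhi s := by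
  rw [show 2 * (varpi / 2) - s = -s + varpi by ring, realPhi_add_varpi, realPhi_neg, neg_neg]

/-- The inverse function rule breaks down here, as `1 / √(1 - r⁴)` blows up at `r = 1`. The left
derivative is instead the limit of `√(1 - φ⁴)`. -/
theorem hasDerivAt_realPhi_half : HasDerivAt realPhi 0 (varpi / 2) := by
  refine hasDerivAt_zero_of_symm (ε := 1) (by simp) (by simpa using realPhi_varpi_sub) (by simp) ?_
  refine hasDerivWithinAt_Iic_of_tendsto_deriv (s := Ioo (-(varpi / 2)) (varpi / 2))
    (fun s hs => (hasDerivAt_realPhi_of_mem_Ioo hs).differentiableAt.differentiableWithinAt)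
    (continuousWithinAt_realPhi_half.mono fun s hs => hs.2.le) Ioo_mem_nhdsLT_half ?_
  have h : Tendsto (fun s => Real.sqrt (1 - realPhi s ^ 4)) (𝓝[<] (varpi / 2)) (𝓝 0) := by
    have := continuousWithinAt_realPhi_half.mono (Iio_subset_Iic_self (a := varpi / 2))
    have h2 := ((this.pow 4).const_sub 1).sqrt
    simpa [realPhi_half] using h2
  refine h.congr' ?_
  filter_upwards [Ioo_mem_nhdsLT_half] with s hs
  exact (hasDerivAt_realPhi_of_mem_Ioo hs).deriv.symm

theorem differentiableAt_realPhi (s : ℝ) : DifferentiableAt ℝ realPhi s := by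
  obtain ⟨n, t, ht, rfl⟩ := exists_int_mem_Ioc s
  have ht' : DifferentiableAt ℝ realPhi t := by
    rcases eq_or_lt_of_le ht.2 with rfl | h
    · exact hasDerivAt_realPhi_half.differentiableAt
    · exact (hasDerivAt_realPhi_of_mem_Ioo ⟨ht.1, h⟩).differentiableAt
  rw [← differentiableAt_comp_add_const, funext (realPhi_add_int varpi_pos.ne' n)]
  exact ht'.const_mul _

theorem hasDerivAt_realPhi (s : ℝ) : HasDerivAt realPhi (deriv realPhi s) s :=
  (differentiableAt_realPhi s).hasDerivAt

theorem deriv_realPhi_half : deriv realPhi (varpi / 2) = 0 := hasDerivAt_realPhi_half.deriv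

theorem deriv_realPhi_of_mem_Ioc {s : ℝ} (hs : s ∈ Ioc (-(varpi / 2)) (varpi / 2)) :
    deriv realPhi s = Real.sqrt (1 - realPhi s ^ 4) := by
  rcases eq_or_lt_of_le hs.2 with rfl | h
  · simp [deriv_realPhi_half, realPhi_half]
  · exact (hasDerivAt_realPhi_of_mem_Ioo ⟨hs.1, h⟩).deriv

theorem deriv_realPhi_zero : deriv realPhi 0 = 1 := by
  have hv := varpi_pos
  rw [deriv_realPhi_of_mem_Ioc ⟨by linarith, by linarith⟩]
  simp [realPhi_zero]

theorem deriv_realPhi_neg (s : ℝ) : deriv realPhi (-s) = deriv realPhi s := by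
  have h1 : HasDerivAt (fun s => -realPhi (-s)) (-(deriv realPhi (-s) * (-1))) s :=
    ((hasDerivAt_realPhi (-s)).comp s (hasDerivAt_neg s)).neg
  have : (fun s => -realPhi (-s)) = realPhi := by ext t; rw [realPhi_neg, neg_neg]
  rw [this] at h1
  rw [h1.deriv]; ring

theorem neg_one_zpow_sq (n : ℤ) : ((-1 : ℝ) ^ n) ^ 2 = 1 := by
  rcases Int.even_or_odd n with h | h <;> simp [h.neg_one_zpow]

theorem deriv_realPhi_sq (s : ℝ) : deriv realPhi s ^ 2 = 1 - realPhi s ^ 4 := by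
  obtain ⟨n, t, ht, rfl⟩ := exists_int_mem_Ioc s
  have hm := realPhi_mem (Ioc_subset_Icc_self ht)
  have h : 0 ≤ 1 - realPhi t ^ 4 := by
    have : realPhi t ^ 2 ≤ 1 := by nlinarith [hm.1, hm.2]
    nlinarith [sq_nonneg (realPhi t)]
  rw [deriv_realPhi_add_int varpi_pos.ne', realPhi_add_int varpi_pos.ne',
    deriv_realPhi_of_mem_Ioc ht]
  have := neg_one_zpow_sq n
  rw [mul_pow, mul_pow, Real.sq_sqrt h, this]
  linear_combination (realPhi t ^ 4 * (((-1 : ℝ) ^ n) ^ 2 + 1)) * this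

/-- Differentiating `φ' = √(1 - φ⁴)` works inside the fundamental interval; the endpoint follows
from the antisymmetry of `φ'` about `ϖ/2`, and all other points by antiperiodicity. -/
theorem hasDerivAt_deriv_realPhi (s : ℝ) :
    HasDerivAt (deriv realPhi) (-2 * realPhi s ^ 3) s := by
  have key : ∀ s ∈ Ioo (-(varpi / 2)) (varpi / 2),
      HasDerivAt (deriv realPhi) (-2 * realPhi s ^ 3) s := by
    intro s hs
    have hp := one_sub_pow_four_pos (realPhi_mem_Ioo hs)
    have h1 := (((hasDerivAt_realPhi_of_mem_Ioo hs).pow 4).const_sub 1).sqrt hp.ne'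
    refine (h1.congr_of_eventuallyEq ?_).congr_deriv ?_
    · filter_upwards [Ioo_mem_nhds hs.1 hs.2] with t ht
      exact deriv_realPhi_of_mem_Ioc (Ioo_subset_Ioc_self ht)
    · have := (Real.sqrt_pos.2 hp).ne'
      simp only [Pi.pow_apply]
      field_simp
      norm_num
      ring
  have half : HasDerivAt (deriv realPhi) (-2 * realPhi (varpi / 2) ^ 3) (varpi / 2) := by
    refine hasDerivAt_zero_of_symm (ε := -1) (by ring) (fun s => ?_) (by norm_num) ?_
    · rw [show 2 * (varpi / 2) - s = -s + ((1 : ℤ) : ℝ) * varpi by push_cast; ring,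
        deriv_realPhi_add_int varpi_pos.ne', deriv_realPhi_neg]
      norm_num
    refine hasDerivWithinAt_Iic_of_tendsto_deriv (s := Ioo (-(varpi / 2)) (varpi / 2))
      (fun s hs => (key s hs).differentiableAt.differentiableWithinAt) ?_ Ioo_mem_nhdsLT_half ?_
    · have h2 : ContinuousWithinAt (fun s => Real.sqrt (1 - realPhi s ^ 4))
          (Ioo (-(varpi / 2)) (varpi / 2)) (varpi / 2) := by
        have := (differentiableAt_realPhi (varpi / 2)).continuousAt
        exact (show ContinuousAt _ _ from ((this.pow 4).const_sub 1).sqrt).continuousWithinAt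
      refine h2.congr (fun s hs => deriv_realPhi_of_mem_Ioc (Ioo_subset_Ioc_self hs)) ?_
      simp [deriv_realPhi_half, realPhi_half]
    · have h : Tendsto (fun s => -2 * realPhi s ^ 3) (𝓝[<] (varpi / 2))
          (𝓝 (-2 * realPhi (varpi / 2) ^ 3)) := by
        have := (differentiableAt_realPhi (varpi / 2)).continuousAt
        exact ((this.pow 3).const_mul (-2)).continuousWithinAt
      refine h.congr' ?_
      filter_upwards [Ioo_mem_nhdsLT_half] with s hs
      exact (key s hs).deriv.symm
  obtain ⟨n, t, ht, rfl⟩ := exists_int_mem_Ioc s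
  have ht' : HasDerivAt (deriv realPhi) (-2 * realPhi t ^ 3) t := by
    rcases eq_or_lt_of_le ht.2 with rfl | h
    · exact half
    · exact key t ⟨ht.1, h⟩
  have h3 : HasDerivAt (fun s => deriv realPhi (s + n * varpi))
      ((-1) ^ n * (-2 * realPhi t ^ 3)) t := by
    rw [funext (deriv_realPhi_add_int varpi_pos.ne' n)]
    exact ht'.const_mul _
  have h4 := HasDerivAt.comp_add_const (t + n * varpi) (-(n * varpi)) (f := fun s => deriv realPhi (s + n * varpi))
    (f' := (-1) ^ n * (-2 * realPhi t ^ 3)) (by simpa using h3)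
  refine (h4.congr_of_eventuallyEq (Eventually.of_forall fun x => by simp)).congr_deriv ?_
  rw [realPhi_add_int varpi_pos.ne']
  linear_combination (2 * realPhi t ^ 3 * (-1) ^ n) * neg_one_zpow_sq n

theorem realPhi_sq_le_one (s : ℝ) : realPhi s ^ 2 ≤ 1 := by
  nlinarith [deriv_realPhi_sq s, sq_nonneg (deriv realPhi s), sq_nonneg (realPhi s)]

/-- The shift by a quarter of the period `2ϖ`, a special case of the addition theorem. -/
theorem realPhi_add_half (x : ℝ) :
    realPhi (x + varpi / 2) = deriv realPhi x / (1 + realPhi x ^ 2) := by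
  -- The addition-theorem expression for the arguments `x + t` and `ϖ/2 - t`. Their sum is fixed, so
  -- `F` is constant; its values at `t = ϖ/2` and `t = 0` are the two sides.
  set F : ℝ → ℝ := fun t =>
    (realPhi (x + t) * deriv realPhi (varpi / 2 - t) + realPhi (varpi / 2 - t) * deriv realPhi (x + t)) /
      (1 + realPhi (x + t) ^ 2 * realPhi (varpi / 2 - t) ^ 2) with hF
  have hd : ∀ t, HasDerivAt F 0 t := by
    intro t
    have a1 := (hasDerivAt_realPhi (x + t)).comp_const_add x t
    have a2 := (hasDerivAt_deriv_realPhi (x + t)).comp_const_add x t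
    have b1 := (hasDerivAt_realPhi (varpi / 2 - t)).comp_const_sub (varpi / 2) t
    have b2 := (hasDerivAt_deriv_realPhi (varpi / 2 - t)).comp_const_sub (varpi / 2) t
    have hne : 1 + realPhi (x + t) ^ 2 * realPhi (varpi / 2 - t) ^ 2 ≠ 0 := by positivity
    refine (((a1.mul b2).add (b1.mul a2)).div (((a1.pow 2).mul (b1.pow 2)).const_add 1) hne).congr_deriv ?_
    rw [div_eq_zero_iff]
    left
    have e1 := deriv_realPhi_sq (x + t)
    have e2 := deriv_realPhi_sq (varpi / 2 - t)
    simp only [Pi.add_apply, Pi.mul_apply, Pi.pow_apply]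
    generalize realPhi (x + t) = a at *
    generalize realPhi (varpi / 2 - t) = b at *
    generalize deriv realPhi (x + t) = a' at *
    generalize deriv realPhi (varpi / 2 - t) = b' at *
    push_cast
    ring_nf
    ring_nf at e1 e2
    linear_combination (-2 * a * b ^ 3) * e1 + (2 * a ^ 3 * b) * e2
  have hc : F (varpi / 2) = F 0 :=
    is_const_of_deriv_eq_zero (fun t => (hd t).differentiableAt) (fun t => (hd t).deriv) _ _
  simpa [hF, realPhi_zero, deriv_realPhi_zero, realPhi_half, deriv_realPhi_half] using hc

theorem deriv_realPhi_add_half (x : ℝ) :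
    deriv realPhi (x + varpi / 2) = -2 * realPhi x / (1 + realPhi x ^ 2) := by
  have hne : 1 + realPhi x ^ 2 ≠ 0 := by positivity
  rw [← deriv_comp_add_const, funext realPhi_add_half]
  refine ((hasDerivAt_deriv_realPhi x).div (((hasDerivAt_realPhi x).pow 2).const_add 1) hne).deriv.trans ?_
  have := deriv_realPhi_sq x
  simp only [Pi.pow_apply]
  field_simp
  push_cast
  linear_combination (-2 * realPhi x) * this

theorem realPhi_eq_zero_iff {s : ℝ} : realPhi s = 0 ↔ ∃ n : ℤ, s = n * varpi := by
  constructor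
  · intro h
    obtain ⟨n, t, ht, rfl⟩ := exists_int_mem_Ioc s
    rw [realPhi_add_int varpi_pos.ne'] at h
    have h0 : realPhi t = 0 := by
      rcases mul_eq_zero.1 h with h | h
      · exact absurd h (zpow_ne_zero _ (by norm_num))
      · exact h
    refine ⟨n, ?_⟩
    have := arcLength_realPhi (Ioc_subset_Icc_self ht)
    rw [h0, arcLength_zero] at this
    rw [← this, zero_add]
  · rintro ⟨n, rfl⟩
    have := realPhi_add_int varpi_pos.ne' n 0
    rwa [zero_add, realPhi_zero, mul_zero] at this

/-! ### The complex function: symmetries, zeros and poles -/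

theorem phi_neg (z : ℂ) : phi (-z) = -phi z := by
  simp only [phi, Complex.neg_re, Complex.neg_im, realPhi_neg, deriv_realPhi_neg]
  push_cast
  rw [← neg_div]
  congr 1 <;> ring

theorem phi_zero : phi 0 = 0 := by simp [phi, realPhi_zero]

theorem phi_add_varpi (z : ℂ) : phi (z + varpi) = -phi z := by
  have h1 : realPhi (z.re + varpi) = -realPhi z.re := realPhi_add_varpi _
  have h2 : deriv realPhi (z.re + varpi) = -deriv realPhi z.re := by
    simpa using deriv_realPhi_add_int varpi_pos.ne' 1 z.re
  simp only [phi, Complex.add_re, Complex.add_im, Complex.ofReal_re, Complex.ofReal_im, add_zero,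
    h1, h2]
  push_cast
  rw [← neg_div]
  congr 1 <;> ring

theorem phi_varpi_half : phi (varpi / 2) = 1 := by
  have h1 : ((varpi : ℂ) / 2).re = varpi / 2 := by simp
  have h2 : ((varpi : ℂ) / 2).im = 0 := by simp
  simp [phi, h1, h2, realPhi_zero, deriv_realPhi_zero, realPhi_half]

theorem phi_half_sub (s : ℂ) : phi (varpi / 2 - s) = phi (varpi / 2 + s) := by
  rw [show (varpi : ℂ) / 2 - s = -(varpi / 2 + s) + varpi by ring, phi_add_varpi, phi_neg, neg_neg]

/-- The points at which the denominator in the definition of `phi` vanishes. -/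
def IsPole (z : ℂ) : Prop := realPhi z.re ^ 2 * realPhi z.im ^ 2 = 1

/-- The points of the lattice `ϖ ℤ[i]`. -/
def IsZero (z : ℂ) : Prop := realPhi z.re = 0 ∧ realPhi z.im = 0

theorem isPole_iff {z : ℂ} : IsPole z ↔ realPhi z.re ^ 2 = 1 ∧ realPhi z.im ^ 2 = 1 := by
  have h1 := realPhi_sq_le_one z.re
  have h2 := realPhi_sq_le_one z.im
  refine ⟨fun h => ?_, fun h => by rw [IsPole, h.1, h.2, one_mul]⟩
  unfold IsPole at h
  constructor <;> nlinarith [sq_nonneg (realPhi z.re), sq_nonneg (realPhi z.im)]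

theorem toComplex_mul_varpi_re (g : GaussianInt) : ((g : ℂ) * varpi).re = g.re * varpi := by
  simp [Complex.mul_re]

theorem toComplex_mul_varpi_im (g : GaussianInt) : ((g : ℂ) * varpi).im = g.im * varpi := by
  simp [Complex.mul_im]

theorem isZero_iff {z : ℂ} : IsZero z ↔ ∃ g : GaussianInt, z = (g : ℂ) * varpi := by
  simp only [IsZero, realPhi_eq_zero_iff]
  constructor
  · rintro ⟨⟨m, hm⟩, ⟨n, hn⟩⟩
    refine ⟨⟨m, n⟩, ?_⟩
    apply Complex.ext
    · rw [hm, toComplex_mul_varpi_re]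
    · rw [hn, toComplex_mul_varpi_im]
  · rintro ⟨g, rfl⟩
    exact ⟨⟨g.re, toComplex_mul_varpi_re g⟩, ⟨g.im, toComplex_mul_varpi_im g⟩⟩

/-- The pole `(1 + i) ϖ / 2`. -/
noncomputable def polePoint : ℂ := (1 + Complex.I) * varpi / 2

theorem add_polePoint_re (z : ℂ) : (z + polePoint).re = z.re + varpi / 2 := by
  simp [polePoint]

theorem add_polePoint_im (z : ℂ) : (z + polePoint).im = z.im + varpi / 2 := by
  simp [polePoint]

theorem deriv_realPhi_eq_zero_iff {s : ℝ} : deriv realPhi s = 0 ↔ realPhi s ^ 2 = 1 := by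
  have h := deriv_realPhi_sq s
  constructor
  · intro h0
    rw [h0] at h
    nlinarith [sq_nonneg (realPhi s)]
  · intro h0
    have : deriv realPhi s ^ 2 = 0 := by rw [h, show 4 = 2 * 2 from rfl, pow_mul, h0]; norm_num
    exact pow_eq_zero_iff (two_ne_zero) |>.1 this

theorem realPhi_add_half_eq_zero_iff {s : ℝ} : realPhi (s + varpi / 2) = 0 ↔ realPhi s ^ 2 = 1 := by
  rw [realPhi_add_half, div_eq_zero_iff, deriv_realPhi_eq_zero_iff]
  refine or_iff_left ?_
  positivity

theorem isZero_add_polePoint {z : ℂ} : IsZero (z + polePoint) ↔ IsPole z := by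
  rw [isPole_iff, IsZero, add_polePoint_re, add_polePoint_im, realPhi_add_half_eq_zero_iff,
    realPhi_add_half_eq_zero_iff]

theorem isZero_add {z : ℂ} (g : GaussianInt) : IsZero (z + (g : ℂ) * varpi) ↔ IsZero z := by
  simp only [isZero_iff]
  constructor
  · rintro ⟨h, hh⟩
    exact ⟨h - g, by rw [map_sub]; linear_combination hh⟩
  · rintro ⟨h, hh⟩
    exact ⟨h + g, by rw [map_add]; linear_combination hh⟩

theorem isPole_add_polePoint {z : ℂ} : IsPole (z + polePoint) ↔ IsZero z := by
  rw [← isZero_add_polePoint, ← isZero_add (z := z) ⟨1, 1⟩]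
  apply iff_of_eq
  congr 1
  simp only [polePoint, GaussianInt.toComplex_def₂]
  apply Complex.ext <;> simp <;> ring

theorem IsZero.not_isPole {z : ℂ} (h : IsZero z) : ¬ IsPole z := by
  simp [IsPole, h.1]

theorem phi_eq_zero_of_isPole {z : ℂ} (h : IsPole z) : phi z = 0 := by
  unfold IsPole at h
  have h' : (realPhi z.re : ℂ) ^ 2 * (realPhi z.im : ℂ) ^ 2 = 1 := by exact_mod_cast h
  simp [phi, h']

/-- This translation exchanges zeros and poles, so the behaviour at poles is read off from the
zeros. With `phi = 0` at poles and `0⁻¹ = 0` the identity needs no exceptions. -/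
theorem phi_add_polePoint (z : ℂ) : phi (z + polePoint) = -Complex.I * (phi z)⁻¹ := by
  by_cases hp : IsPole z
  · rw [phi_eq_zero_of_isPole hp]
    have := isZero_add_polePoint.2 hp
    simp only [phi, this.1, this.2]
    simp
  by_cases hz : IsZero z
  · rw [phi_eq_zero_of_isPole (isPole_add_polePoint.2 hz)]
    simp [phi, hz.1, hz.2]
  have e1 : ((deriv realPhi z.re : ℝ) : ℂ) ^ 2 = 1 - (realPhi z.re : ℂ) ^ 4 := by
    exact_mod_cast deriv_realPhi_sq z.re
  have e2 : ((deriv realPhi z.im : ℝ) : ℂ) ^ 2 = 1 - (realPhi z.im : ℂ) ^ 4 := by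
    exact_mod_cast deriv_realPhi_sq z.im
  have hD : (1 - (realPhi z.re : ℂ) ^ 2 * (realPhi z.im : ℂ) ^ 2) ≠ 0 := by
    intro h
    exact hp (by unfold IsPole; exact_mod_cast (sub_eq_zero.1 h).symm)
  have hS : (realPhi z.re : ℂ) ^ 2 + (realPhi z.im : ℂ) ^ 2 ≠ 0 := by
    intro h
    have h' : realPhi z.re ^ 2 + realPhi z.im ^ 2 = 0 := by exact_mod_cast h
    exact hz ⟨by nlinarith [sq_nonneg (realPhi z.re), sq_nonneg (realPhi z.im)],
      by nlinarith [sq_nonneg (realPhi z.re), sq_nonneg (realPhi z.im)]⟩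
  have hA : (1 + (realPhi z.re : ℂ) ^ 2) ≠ 0 := by
    exact_mod_cast (by positivity : (1 + realPhi z.re ^ 2) ≠ 0)
  have hB : (1 + (realPhi z.im : ℂ) ^ 2) ≠ 0 := by
    exact_mod_cast (by positivity : (1 + realPhi z.im ^ 2) ≠ 0)
  unfold phi
  rw [add_polePoint_re, add_polePoint_im, realPhi_add_half, realPhi_add_half,
    deriv_realPhi_add_half, deriv_realPhi_add_half]
  push_cast
  generalize (realPhi z.re : ℂ) = a at *
  generalize (realPhi z.im : ℂ) = b at *
  generalize ((deriv realPhi z.re : ℝ) : ℂ) = a' at *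
  generalize ((deriv realPhi z.im : ℝ) : ℂ) = b' at *
  -- The numerator of `phi` times its formal conjugate factors by `φ'² = 1 - φ⁴`; this is what turns
  -- the translated quotient into a reciprocal.
  have hN : (a * b' + Complex.I * b * a') * (a * b' - Complex.I * b * a') =
      (a ^ 2 + b ^ 2) * (1 - a ^ 2 * b ^ 2) := by
    linear_combination b ^ 2 * e1 + a ^ 2 * e2 - b ^ 2 * a' ^ 2 * Complex.I_sq
  have hN0 : a * b' + Complex.I * b * a' ≠ 0 := by
    intro h
    rw [h, zero_mul] at hN
    exact mul_ne_zero hS hD hN.symm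
  have hden : (1 - (a' / (1 + a ^ 2)) ^ 2 * (b' / (1 + b ^ 2)) ^ 2) =
      2 * (a ^ 2 + b ^ 2) / ((1 + a ^ 2) * (1 + b ^ 2)) := by
    field_simp
    linear_combination (-b' ^ 2) * e1 - (1 - a ^ 4) * e2
  rw [hden]
  generalize a * b' + Complex.I * b * a' = n at *
  field_simp
  linear_combination (-Complex.I) * hN + (-a' * b * n) * Complex.I_sq

/-! ### Holomorphy and orders of the complex function -/

/-- The derivative of `phi`, computed along the real direction. -/
noncomputable def phiDeriv (z : ℂ) : ℂ :=
  ((((deriv realPhi z.re : ℝ) : ℂ) * ((deriv realPhi z.im : ℝ) : ℂ)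
      - 2 * Complex.I * (realPhi z.im : ℂ) * (realPhi z.re : ℂ) ^ 3)
        * (1 - (realPhi z.re : ℂ) ^ 2 * (realPhi z.im : ℂ) ^ 2)
    + ((realPhi z.re : ℂ) * ((deriv realPhi z.im : ℝ) : ℂ)
      + Complex.I * (realPhi z.im : ℂ) * ((deriv realPhi z.re : ℝ) : ℂ))
        * (2 * (realPhi z.re : ℂ) * ((deriv realPhi z.re : ℝ) : ℂ) * (realPhi z.im : ℂ) ^ 2))
    / (1 - (realPhi z.re : ℂ) ^ 2 * (realPhi z.im : ℂ) ^ 2) ^ 2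

/-- Real differentiability comes from the coordinates; complex linearity of the differential is the
Cauchy–Riemann equation, which follows from `φ'² = 1 - φ⁴` in each coordinate. -/
theorem hasDerivAt_phi {z : ℂ} (hp : ¬ IsPole z) : HasDerivAt phi (phiDeriv z) z := by
  have hD : (1 - (realPhi z.re : ℂ) ^ 2 * (realPhi z.im : ℂ) ^ 2) ≠ 0 := by
    intro h
    exact hp (by unfold IsPole; exact_mod_cast (sub_eq_zero.1 h).symm)
  have lift_re : ∀ {f : ℝ → ℝ} {f' : ℝ}, HasDerivAt f f' z.re →
      HasFDerivAt (fun w : ℂ => (f w.re : ℂ)) (Complex.reCLM.smulRight (f' : ℂ)) z := by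
    intro f f' h
    have h1 := (h.ofReal_comp.hasFDerivAt).comp z (Complex.reCLM.hasFDerivAt (x := z))
    refine h1.congr_fderiv ?_
    ext w
    simp
  have lift_im : ∀ {f : ℝ → ℝ} {f' : ℝ}, HasDerivAt f f' z.im →
      HasFDerivAt (fun w : ℂ => (f w.im : ℂ)) (Complex.imCLM.smulRight (f' : ℂ)) z := by
    intro f f' h
    have h1 := (h.ofReal_comp.hasFDerivAt).comp z (Complex.imCLM.hasFDerivAt (x := z))
    refine h1.congr_fderiv ?_
    ext w
    simp
  have a1 := lift_re (hasDerivAt_realPhi z.re)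
  have a2 := lift_re (hasDerivAt_deriv_realPhi z.re)
  have b1 := lift_im (hasDerivAt_realPhi z.im)
  have b2 := lift_im (hasDerivAt_deriv_realPhi z.im)
  have hN := (a1.mul b2).add ((b1.const_mul Complex.I).mul a2)
  have hDen := ((a1.mul a1).mul (b1.mul b1)).const_sub 1
  have hinv := (hasDerivAt_inv (x := 1 - (realPhi z.re * realPhi z.re : ℂ) * (realPhi z.im * realPhi z.im)) (by
    intro h; apply hD; rw [← h]; ring)).hasFDerivAt.restrictScalars ℝ
  have hall := hN.mul (hinv.comp z hDen)
  have hall' : HasFDerivAt phi _ z := hall.congr_of_eventuallyEq (Eventually.of_forall fun w => by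
    simp [phi, div_eq_mul_inv, pow_two])
  refine HasFDerivAt.hasDerivAt (f' := ContinuousLinearMap.toSpanSingleton ℂ (phiDeriv z)) ?_ |>.congr_deriv (by simp)
  refine hasFDerivAt_of_restrictScalars ℝ hall' ?_
  have e1 : ((deriv realPhi z.re : ℝ) : ℂ) ^ 2 = 1 - (realPhi z.re : ℂ) ^ 4 := by
    exact_mod_cast deriv_realPhi_sq z.re
  have e2 : ((deriv realPhi z.im : ℝ) : ℂ) ^ 2 = 1 - (realPhi z.im : ℂ) ^ 4 := by
    exact_mod_cast deriv_realPhi_sq z.im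
  apply ContinuousLinearMap.coe_injective
  -- On the basis vector `1` the differential is `phiDeriv` by construction; the vector `I` is where
  -- Cauchy–Riemann enters.
  refine Complex.basisOneI.ext fun i => ?_
  have hD' : 1 - (realPhi z.re * realPhi z.re : ℂ) * (realPhi z.im * realPhi z.im) ≠ 0 := by
    intro h; apply hD; rw [← h]; ring
  fin_cases i
  · simp [phiDeriv]
    generalize (realPhi z.re : ℂ) = a at *
    generalize (realPhi z.im : ℂ) = b at *
    generalize ((deriv realPhi z.re : ℝ) : ℂ) = a' at *
    generalize ((deriv realPhi z.im : ℝ) : ℂ) = b' at *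
    rw [← pow_two, ← pow_two] at *
    field_simp
    ring
  · simp [phiDeriv]
    generalize (realPhi z.re : ℂ) = a at *
    generalize (realPhi z.im : ℂ) = b at *
    generalize ((deriv realPhi z.re : ℝ) : ℂ) = a' at *
    generalize ((deriv realPhi z.im : ℝ) : ℂ) = b' at *
    rw [← pow_two, ← pow_two] at *
    field_simp
    congr 1
    linear_combination (-2 * a * b ^ 3) * e1 + (-2 * a ^ 3 * b) * e2
      + (-2 * b * a ^ 3 * (1 - b ^ 2 * a ^ 2) + 2 * a' ^ 2 * a * b ^ 3) * Complex.I_sq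

theorem phiDeriv_ne_zero {z : ℂ} (hz : IsZero z) : phiDeriv z ≠ 0 := by
  have h1 := mt deriv_realPhi_eq_zero_iff.1 (by rw [hz.1]; norm_num : ¬ realPhi z.re ^ 2 = 1)
  have h2 := mt deriv_realPhi_eq_zero_iff.1 (by rw [hz.2]; norm_num : ¬ realPhi z.im ^ 2 = 1)
  simp [phiDeriv, hz.1, hz.2, h1, h2]

theorem phiDeriv_zero : phiDeriv 0 = 1 := by
  simp [phiDeriv, realPhi_zero, deriv_realPhi_zero]

theorem phi_eq_zero_iff {z : ℂ} (hp : ¬ IsPole z) : phi z = 0 ↔ IsZero z := by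
  constructor
  · intro h
    by_contra hz
    have hN : (realPhi z.re : ℂ) * ((deriv realPhi z.im : ℝ) : ℂ)
        + Complex.I * (realPhi z.im : ℂ) * ((deriv realPhi z.re : ℝ) : ℂ) = 0 := by
      rcases div_eq_zero_iff.1 h with h | h
      · exact h
      · exact absurd (by unfold IsPole; exact_mod_cast (sub_eq_zero.1 h).symm) hp
    have hre := congrArg Complex.re hN
    have him := congrArg Complex.im hN
    simp only [Complex.add_re, Complex.mul_re, Complex.ofReal_re, Complex.ofReal_im, Complex.I_re,
      Complex.I_im, Complex.add_im, Complex.mul_im, Complex.zero_re, Complex.zero_im] at hre him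
    ring_nf at hre him
    -- `φ` and `φ'` never vanish together at a real point, which excludes the two mixed cases; if
    -- both derivatives vanish, the point is a pole.
    rcases mul_eq_zero.1 hre with h1 | h1 <;> rcases mul_eq_zero.1 him with h2 | h2
    · exact hz ⟨h1, h2⟩
    · rw [deriv_realPhi_eq_zero_iff, h1] at h2; norm_num at h2
    · rw [deriv_realPhi_eq_zero_iff, h2] at h1; norm_num at h1
    · exact hp (isPole_iff.2 ⟨deriv_realPhi_eq_zero_iff.1 h2, deriv_realPhi_eq_zero_iff.1 h1⟩)
  · intro h
    simp [phi, h.1, h.2]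

theorem isOpen_not_isPole : IsOpen {z : ℂ | ¬ IsPole z} := by
  have hc : Continuous realPhi := continuous_iff_continuousAt.2 fun s =>
    (differentiableAt_realPhi s).continuousAt
  exact (isClosed_eq (((hc.comp Complex.continuous_re).pow 2).mul
    ((hc.comp Complex.continuous_im).pow 2)) continuous_const).isOpen_compl

theorem analyticAt_phi {z : ℂ} (hp : ¬ IsPole z) : AnalyticAt ℂ phi z := by
  refine DifferentiableOn.analyticAt (s := {z : ℂ | ¬ IsPole z}) (fun w hw => ?_)
    (isOpen_not_isPole.mem_nhds hp)
  exact (hasDerivAt_phi hw).differentiableAt.differentiableWithinAt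

theorem phi_eq_inv (z : ℂ) : phi z = -Complex.I * (phi (z + polePoint))⁻¹ := by
  rw [phi_add_polePoint, mul_inv, inv_inv]
  rw [← mul_assoc, mul_inv_cancel₀ (neg_ne_zero.2 Complex.I_ne_zero), one_mul]

theorem meromorphicAt_phi (z : ℂ) : MeromorphicAt phi z := by
  by_cases hp : IsPole z
  · have h : ¬ IsPole (z + polePoint) := (isZero_add_polePoint.2 hp).not_isPole
    rw [funext phi_eq_inv]
    have h1 : AnalyticAt ℂ (fun w => phi (w + polePoint)) z :=
      (analyticAt_phi h).comp_of_eq (by fun_prop) rfl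
    exact (MeromorphicAt.const _ _).mul h1.meromorphicAt.inv
  · exact (analyticAt_phi hp).meromorphicAt

open Classical in
theorem meromorphicOrderAt_phi_of_not_isPole {z : ℂ} (hp : ¬ IsPole z) :
    meromorphicOrderAt phi z = if IsZero z then 1 else 0 := by
  have ha := analyticAt_phi hp
  rw [ha.meromorphicOrderAt_eq]
  split_ifs with hz
  · rw [ha.analyticOrderAt_eq_one_of_zero_deriv_ne_zero ((phi_eq_zero_iff hp).2 hz)
      (by rw [(hasDerivAt_phi hp).deriv]; exact phiDeriv_ne_zero hz)]
    rfl
  · rw [ha.analyticOrderAt_eq_zero.2 (mt (phi_eq_zero_iff hp).1 hz)]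
    rfl

open Classical in
-- At a pole, `phi_eq_inv` writes `phi` as a constant times the inverse of a function with a simple
-- zero.
theorem meromorphicOrderAt_phi (z : ℂ) : meromorphicOrderAt phi z =
    (((if IsZero z then 1 else 0) - (if IsPole z then 1 else 0) : ℤ) : WithTop ℤ) := by
  by_cases hp : IsPole z
  · have hz' := isZero_add_polePoint.2 hp
    have h := meromorphicOrderAt_phi_of_not_isPole hz'.not_isPole
    rw [if_pos hz'] at h
    rw [if_pos hp, if_neg fun hz => hz.not_isPole hp, funext phi_eq_inv]
    have h1 : meromorphicOrderAt (fun w => phi (w + polePoint)) z = 1 := by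
      rw [← h]
      exact meromorphicOrderAt_comp_add_const_eq_meromorphicOrderAt (f := phi) (c := polePoint)
    have := meromorphicOrderAt_mul_of_ne_zero (f := (fun w => phi (w + polePoint))⁻¹)
      (g := fun _ => -Complex.I) (x := z) analyticAt_const (by simp)
    rw [meromorphicOrderAt_inv, h1] at this
    refine this.trans ?_
    rfl
  · rw [meromorphicOrderAt_phi_of_not_isPole hp, if_neg hp]
    split_ifs <;> rfl

/-- The lemniscate cosine `s ↦ φ(ϖ/2 + s)` takes inverse values at `s` and `i s`. -/
theorem phi_half_add_mul_phi_half_add_I_mul {s : ℂ}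
    (h1 : ¬ (realPhi s.re = 0 ∧ realPhi s.im ^ 2 = 1))
    (h2 : ¬ (realPhi s.im = 0 ∧ realPhi s.re ^ 2 = 1)) :
    phi (varpi / 2 + s) * phi (varpi / 2 + Complex.I * s) = 1 := by
  have r1 : (varpi / 2 + s : ℂ).re = s.re + varpi / 2 := by simp; ring
  have r2 : (varpi / 2 + s : ℂ).im = s.im := by simp
  have r3 : (varpi / 2 + Complex.I * s : ℂ).re = -s.im + varpi / 2 := by simp; ring
  have r4 : (varpi / 2 + Complex.I * s : ℂ).im = s.re := by simp
  have e1 : ((deriv realPhi s.re : ℝ) : ℂ) ^ 2 = 1 - (realPhi s.re : ℂ) ^ 4 := by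
    exact_mod_cast deriv_realPhi_sq s.re
  have e2 : ((deriv realPhi s.im : ℝ) : ℂ) ^ 2 = 1 - (realPhi s.im : ℂ) ^ 4 := by
    exact_mod_cast deriv_realPhi_sq s.im
  have a1 := realPhi_sq_le_one s.re
  have b1 := realPhi_sq_le_one s.im
  have hA : (1 + (realPhi s.re : ℂ) ^ 2) ≠ 0 := by
    exact_mod_cast (by positivity : (1 + realPhi s.re ^ 2) ≠ 0)
  have hB : (1 + (realPhi s.im : ℂ) ^ 2) ≠ 0 := by
    exact_mod_cast (by positivity : (1 + realPhi s.im ^ 2) ≠ 0)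
  -- The expression is `(1 - b²) + a² (1 + b²)`, a sum of nonnegative terms.
  have aux : ∀ {a b : ℝ}, a ^ 2 ≤ 1 → b ^ 2 ≤ 1 → ¬ (a = 0 ∧ b ^ 2 = 1) →
      1 + a ^ 2 - b ^ 2 + a ^ 2 * b ^ 2 ≠ 0 := by
    intro a b ha hb h h0
    have hab : 0 ≤ a ^ 2 * b ^ 2 := by positivity
    have ha0 : a ^ 2 = 0 := by nlinarith [sq_nonneg a]
    exact h ⟨pow_eq_zero_iff two_ne_zero |>.1 ha0, by rw [ha0] at h0; linarith⟩
  have hD1 : (1 + (realPhi s.re : ℂ) ^ 2 - (realPhi s.im : ℂ) ^ 2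
      + (realPhi s.re : ℂ) ^ 2 * (realPhi s.im : ℂ) ^ 2) ≠ 0 := by exact_mod_cast aux a1 b1 h1
  have hD2 : (1 + (realPhi s.im : ℂ) ^ 2 - (realPhi s.re : ℂ) ^ 2
      + (realPhi s.im : ℂ) ^ 2 * (realPhi s.re : ℂ) ^ 2) ≠ 0 := by exact_mod_cast aux b1 a1 h2
  unfold phi
  rw [r1, r2, r3, r4, realPhi_add_half, realPhi_add_half, deriv_realPhi_add_half,
    deriv_realPhi_add_half, realPhi_neg, deriv_realPhi_neg]
  push_cast
  generalize (realPhi s.re : ℂ) = a at *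
  generalize (realPhi s.im : ℂ) = b at *
  generalize ((deriv realPhi s.re : ℝ) : ℂ) = a' at *
  generalize ((deriv realPhi s.im : ℝ) : ℂ) = b' at *
  have n1 : 1 - (a' / (1 + a ^ 2)) ^ 2 * b ^ 2 =
      (1 + a ^ 2 - b ^ 2 + a ^ 2 * b ^ 2) / (1 + a ^ 2) := by
    field_simp
    linear_combination (-b ^ 2) * e1
  have n2 : 1 - (b' / (1 + (-b) ^ 2)) ^ 2 * a ^ 2 =
      (1 + b ^ 2 - a ^ 2 + b ^ 2 * a ^ 2) / (1 + b ^ 2) := by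
    rw [neg_pow_two]
    field_simp
    linear_combination (-a ^ 2) * e2
  rw [n1, n2, neg_pow_two]
  generalize hd1 : 1 + a ^ 2 - b ^ 2 + a ^ 2 * b ^ 2 = d1 at *
  generalize hd2 : 1 + b ^ 2 - a ^ 2 + b ^ 2 * a ^ 2 = d2 at *
  field_simp
  rw [← hd1, ← hd2]
  linear_combination b' ^ 2 * e1 + (1 - a ^ 4) * e2 - 4 * a ^ 2 * b ^ 2 * Complex.I_sq

/-! ### Liouville's theorem for doubly periodic functions -/

theorem eq_of_eventuallyEq_nhdsNE {f g : ℂ → ℂ} {z : ℂ} (hf : ContinuousAt f z)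
    (hg : ContinuousAt g z) (h : f =ᶠ[𝓝[≠] z] g) : f z = g z :=
  tendsto_nhds_unique (hf.mono_left nhdsWithin_le_nhds)
    ((hg.mono_left nhdsWithin_le_nhds).congr' h.symm)

theorem exists_bound_of_periodic {f : ℂ → ℂ} (hf : Continuous f) {ω : ℝ} (hω : 0 < ω)
    (h1 : ∀ z, f (z + ω) = f z) (h2 : ∀ z, f (z + ω * Complex.I) = f z) :
    ∃ C, ∀ z, ‖f z‖ ≤ C := by
  have hK : IsCompact (Icc 0 ω ×ℂ Icc 0 ω) := isCompact_Icc.reProdIm isCompact_Icc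
  obtain ⟨C, hC⟩ := hK.exists_bound_of_continuousOn hf.continuousOn
  refine ⟨C, fun z => ?_⟩
  have p1 : Function.Periodic f (ω : ℂ) := h1
  have p2 : Function.Periodic f ((ω : ℂ) * Complex.I) := h2
  have e : f (z - ⌊z.re / ω⌋ * (ω : ℂ) - ⌊z.im / ω⌋ * ((ω : ℂ) * Complex.I)) = f z := by
    rw [p2.sub_int_mul_eq, p1.sub_int_mul_eq]
  rw [← e]
  have b : ∀ x : ℝ, x - ⌊x / ω⌋ * ω ∈ Icc 0 ω := by
    intro x
    have l1 := Int.floor_le (x / ω)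
    have l2 := Int.lt_floor_add_one (x / ω)
    rw [le_div_iff₀ hω] at l1
    rw [div_lt_iff₀ hω] at l2
    constructor <;> linarith
  refine hC _ ?_
  rw [Complex.mem_reProdIm]
  constructor
  · simpa using b z.re
  · simpa using b z.im

/-- A doubly periodic meromorphic function without poles is constant. -/
theorem exists_eventuallyEq_const_of_periodic {K : ℂ → ℂ} (hK : ∀ z, MeromorphicAt K z)
    (h0 : ∀ z, 0 ≤ meromorphicOrderAt K z) {ω : ℝ} (hω : 0 < ω)
    (h1 : ∀ z, K (z + ω) = K z) (h2 : ∀ z, K (z + ω * Complex.I) = K z) :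
    ∃ κ, ∀ z, K =ᶠ[𝓝[≠] z] fun _ => κ := by
  have hKu : MeromorphicOn K univ := fun z _ => hK z
  -- Passing to the normal form corrects the values at removable singularities, making the function
  -- entire. Its periodicity has to be recovered by continuity.
  set f := toMeromorphicNFOn K univ with hf
  have hfK : ∀ z, f =ᶠ[𝓝[≠] z] K := fun z =>
    (hKu.toMeromorphicNFOn_eq_self_on_nhdsNE (mem_univ z))
  have han : ∀ z, AnalyticAt ℂ f z := by
    intro z
    have hn : MeromorphicNFAt f z := meromorphicNFOn_toMeromorphicNFOn K univ (mem_univ z)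
    rw [← hn.meromorphicOrderAt_nonneg_iff_analyticAt, hf, meromorphicOrderAt_toMeromorphicNFOn hKu (mem_univ z)]
    exact h0 z
  have hc : Continuous f := continuous_iff_continuousAt.2 fun z => (han z).continuousAt
  have per : ∀ c : ℂ, (∀ z, K (z + c) = K z) → ∀ z, f (z + c) = f z := by
    intro c hc' z
    refine eq_of_eventuallyEq_nhdsNE (f := fun w => f (w + c)) (by fun_prop) hc.continuousAt ?_
    have ht : Tendsto (fun w => w + c) (𝓝[≠] z) (𝓝[≠] (z + c)) := by
      refine tendsto_nhdsWithin_of_tendsto_nhds_of_eventually_within _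
        ((by fun_prop : Continuous fun w : ℂ => w + c).tendsto z |>.mono_left nhdsWithin_le_nhds) ?_
      filter_upwards [self_mem_nhdsWithin] with w hw
      simpa using hw
    filter_upwards [ht.eventually (hfK (z + c)), hfK z] with w hw1 hw2
    rw [hw1, hw2, hc']
  obtain ⟨C, hC⟩ := exists_bound_of_periodic hc hω (per _ h1) (per _ h2)
  have hb : Bornology.IsBounded (range f) :=
    (Metric.isBounded_closedBall (x := (0 : ℂ)) (r := C)).subset (by
      rintro _ ⟨z, rfl⟩
      simpa using hC z)
  have hd : Differentiable ℂ f := fun z => (han z).differentiableAt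
  refine ⟨f 0, fun z => ?_⟩
  filter_upwards [hfK z] with w hw
  rw [← hw, hd.apply_eq_apply_of_bounded hb w 0]

/-! ### Division points and their position relative to zeros and poles -/

theorem finite_quotient {β : GaussianInt} (hβ : β ≠ 0) : Finite (GaussianInt ⧸ Ideal.span {β}) := by
  set n := β.norm with hn
  have hpos : 0 < n := GaussianInt.norm_pos.2 hβ
  have hdvd : β ∣ (n : GaussianInt) := ⟨star β, by rw [hn, Zsqrtd.norm_eq_mul_conj]⟩
  refine Finite.of_surjective (fun p : Finset.Ico (0 : ℤ) n × Finset.Ico (0 : ℤ) n =>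
    Ideal.Quotient.mk (Ideal.span {β}) ⟨p.1, p.2⟩) fun q => ?_
  obtain ⟨α, rfl⟩ := Ideal.Quotient.mk_surjective q
  refine ⟨(⟨α.re % n, ?_⟩, ⟨α.im % n, ?_⟩), ?_⟩
  · simp [Int.emod_nonneg _ hpos.ne', Int.emod_lt_of_pos _ hpos]
  · simp [Int.emod_nonneg _ hpos.ne', Int.emod_lt_of_pos _ hpos]
  · rw [Ideal.Quotient.eq, Ideal.mem_span_singleton]
    refine hdvd.trans ⟨⟨-(α.re / n), -(α.im / n)⟩, ?_⟩
    have e1 := Int.emod_add_mul_ediv α.re n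
    have e2 := Int.emod_add_mul_ediv α.im n
    apply Zsqrtd.ext <;> simp <;> linarith

theorem onePlusI_toComplex : (onePlusI : ℂ) = 1 + Complex.I := by
  simp [onePlusI, GaussianInt.toComplex_def]

theorem toComplex_ne_zero {β : GaussianInt} (hβ : β ≠ 0) : (β : ℂ) ≠ 0 := by simpa using hβ

theorem not_isUnit_onePlusI : ¬ IsUnit onePlusI := by
  intro h
  rw [Zsqrtd.isUnit_iff_norm_isUnit] at h
  simp [onePlusI, Zsqrtd.norm, Int.isUnit_iff] at h

theorem IsOdd.ne_zero {β : GaussianInt} (h : IsOdd β) : β ≠ 0 := by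
  rintro rfl
  exact not_isUnit_onePlusI (isCoprime_zero_left.1 h)

theorem two_eq : (2 : GaussianInt) = onePlusI * ⟨1, -1⟩ := by
  apply Zsqrtd.ext <;> simp [onePlusI]

theorem two_eq' : (2 : GaussianInt) = onePlusI ^ 2 * ⟨0, -1⟩ := by
  apply Zsqrtd.ext <;> simp [onePlusI, pow_two]

theorem IsOdd.isCoprime_two {β : GaussianInt} (h : IsOdd β) : IsCoprime β 2 := by
  rw [two_eq']
  refine (IsCoprime.pow_right h).mul_right ?_
  exact ⟨0, ⟨0, 1⟩, by apply Zsqrtd.ext <;> simp⟩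

theorem toComplex_two : ((2 : GaussianInt) : ℂ) = 2 := map_ofNat _ 2

/-- Clearing denominators in a relation with `g ϖ` gives `2 α (1 + i) = (2 g - h) β`, and the odd
`β` cancels modulo 2. Suitable `h` keep the points needed below away from the poles. -/
theorem not_isZero_add_half {β : GaussianInt} (hβ : IsOdd β) (α : GaussianInt) {h : GaussianInt}
    (hh : ¬ 2 ∣ h) : ¬ IsZero ((α : ℂ) * delta β + h * varpi / 2) := by
  rw [isZero_iff]
  rintro ⟨g, hg⟩
  have hb := toComplex_ne_zero hβ.ne_zero
  have hv : (varpi : ℂ) ≠ 0 := by exact_mod_cast varpi_pos.ne'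
  have e : ((2 * (α * onePlusI) : GaussianInt) : ℂ) = ((2 * g - h) * β : GaussianInt) := by
    simp only [map_mul, map_sub, toComplex_two]
    unfold delta at hg
    field_simp at hg
    linear_combination hg
  have e' := GaussianInt.toComplex_injective e
  have : (2 : GaussianInt) ∣ 2 * g - h :=
    hβ.isCoprime_two.symm.dvd_of_dvd_mul_right (Dvd.intro _ e')
  exact hh ((dvd_sub_right (Dvd.intro _ rfl)).1 this)

theorem not_two_dvd {h : GaussianInt} (hh : ¬ (2 ∣ h.re ∧ 2 ∣ h.im)) : ¬ 2 ∣ h := by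
  rintro ⟨k, rfl⟩
  apply hh
  rw [show (2 : GaussianInt) = ((2 : ℤ) : GaussianInt) by norm_num]
  simp

theorem phi_add_delta_congr {β : GaussianInt} (hβ : β ≠ 0) {α α' : GaussianInt} (h : β ∣ α - α')
    (z : ℂ) : phi (z + (α : ℂ) * delta β) = phi (z + (α' : ℂ) * delta β) := by
  obtain ⟨g, hg⟩ := h
  have hb := toComplex_ne_zero hβ
  rw [sub_eq_iff_eq_add'.1 hg, ← phi_add_lattice (z + (α' : ℂ) * delta β) g]
  congr 1
  unfold delta
  rw [map_add, map_mul]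
  field_simp
  ring

/-- The division point `α δ_β` for the chosen representative `α` of a class modulo `β`. -/
noncomputable def divisionPoint (β : GaussianInt) (c : GaussianInt ⧸ Ideal.span {β}) : ℂ :=
  ((Quotient.out c : GaussianInt) : ℂ) * delta β

theorem mk_out {β : GaussianInt} (c : GaussianInt ⧸ Ideal.span {β}) :
    Ideal.Quotient.mk (Ideal.span {β}) (Quotient.out c) = c := Quotient.out_eq c

theorem phi_add_divisionPoint {β : GaussianInt} (hβ : β ≠ 0) (α : GaussianInt) (z : ℂ) :
    phi (z + divisionPoint β (Ideal.Quotient.mk _ α)) = phi (z + (α : ℂ) * delta β) := by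
  refine phi_add_delta_congr hβ ?_ z
  have h := mk_out (Ideal.Quotient.mk (Ideal.span {β}) α)
  rwa [Ideal.Quotient.eq, Ideal.mem_span_singleton] at h

theorem isUnit_mk {β γ : GaussianInt} :
    IsUnit (Ideal.Quotient.mk (Ideal.span {β}) γ) ↔ IsCoprime γ β := by
  constructor
  · intro h
    obtain ⟨y, hy⟩ := h.exists_right_inv
    obtain ⟨y, rfl⟩ := Ideal.Quotient.mk_surjective y
    rw [← map_mul, ← map_one (Ideal.Quotient.mk (Ideal.span {β})), Ideal.Quotient.eq,
      Ideal.mem_span_singleton] at hy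
    obtain ⟨t, ht⟩ := hy
    exact ⟨y, -t, by linear_combination ht⟩
  · rintro ⟨a, b, hab⟩
    refine IsUnit.of_mul_eq_one (Ideal.Quotient.mk _ a) ?_
    rw [← map_mul, ← map_one (Ideal.Quotient.mk (Ideal.span {β})), Ideal.Quotient.eq,
      Ideal.mem_span_singleton]
    exact ⟨-b, by linear_combination hab⟩

open Classical in
-- If `β z = g ϖ`, the translate by `α δ_β` is a zero exactly when `g + α (1 + i) ≡ 0` mod `β`. As
-- `1 + i` is invertible mod `β`, exactly one class qualifies.
theorem sum_isZero_add_divisionPoint {β : GaussianInt} (hβ : IsOdd β)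
    [Fintype (GaussianInt ⧸ Ideal.span {β})] (z : ℂ) :
    ∑ c, (if IsZero (z + divisionPoint β c) then 1 else 0 : ℤ) =
      if IsZero (β * z) then 1 else 0 := by
  have hb := toComplex_ne_zero hβ.ne_zero
  have hv : (varpi : ℂ) ≠ 0 := by exact_mod_cast varpi_pos.ne'
  split_ifs with h
  · obtain ⟨g, hg⟩ := isZero_iff.1 h
    obtain ⟨u, hu⟩ := isUnit_mk.2 hβ.symm
    have key : ∀ c, IsZero (z + divisionPoint β c) ↔
        c = -(Ideal.Quotient.mk (Ideal.span {β}) g) * ((u⁻¹ : Units _) : _ ⧸ Ideal.span {β}) := by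
      intro c
      rw [Units.eq_mul_inv_iff_mul_eq, eq_neg_iff_add_eq_zero, hu]
      conv_rhs => rw [← mk_out c]
      rw [← map_mul, ← map_add, Ideal.Quotient.eq_zero_iff_mem, Ideal.mem_span_singleton, isZero_iff]
      constructor
      · rintro ⟨t, ht⟩
        refine ⟨t, GaussianInt.toComplex_injective ?_⟩
        simp only [map_add, map_mul]
        unfold divisionPoint delta at ht
        field_simp at ht
        apply mul_right_cancel₀ hv
        linear_combination ht - hg
      · rintro ⟨t, ht⟩
        refine ⟨t, ?_⟩
        have ht' := congrArg GaussianInt.toComplex ht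
        simp only [map_add, map_mul] at ht'
        unfold divisionPoint delta
        field_simp
        linear_combination (varpi : ℂ) * ht' + hg
    simp only [key]
    simp
  · refine Finset.sum_eq_zero fun c _ => if_neg fun hc => h ?_
    obtain ⟨t, ht⟩ := isZero_iff.1 hc
    refine isZero_iff.2 ⟨β * t - Quotient.out c * onePlusI, ?_⟩
    simp only [map_sub, map_mul]
    unfold divisionPoint delta at ht
    field_simp at ht
    linear_combination ht

open Classical in
-- Poles are zeros shifted by `polePoint`, and normalization makes `β * polePoint` congruent to
-- `polePoint` modulo `ϖ ℤ[i]`.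
theorem sum_isPole_add_divisionPoint {β : GaussianInt} (hβ : IsNormalized β)
    [Fintype (GaussianInt ⧸ Ideal.span {β})] (z : ℂ) :
    ∑ c, (if IsPole (z + divisionPoint β c) then 1 else 0 : ℤ) =
      if IsPole (β * z) then 1 else 0 := by
  have h := sum_isZero_add_divisionPoint hβ.1 (z + polePoint)
  obtain ⟨t, ht⟩ := hβ.2
  have e : (β : ℂ) * (z + polePoint) = β * z + polePoint + ((onePlusI ^ 2 * t : GaussianInt) : ℂ) * varpi := by
    have ht' := congrArg GaussianInt.toComplex ht
    simp only [map_sub, map_mul, map_one, map_pow, toComplex_two, onePlusI_toComplex] at ht' ⊢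
    unfold polePoint
    linear_combination ((1 + Complex.I) * varpi / 2) * ht'
  simp only [e, isZero_add, isZero_add_polePoint, add_right_comm z polePoint] at h
  exact h

/-! ### The product formula up to a constant -/

theorem meromorphicAt_phi_comp_const_mul (b z : ℂ) :
    MeromorphicAt (fun w => phi (b * w)) z :=
  (meromorphicAt_phi (b * z)).comp_analyticAt (by fun_prop)

theorem meromorphicOrderAt_phi_comp_const_mul {b : ℂ} (hb : b ≠ 0) (z : ℂ) :
    meromorphicOrderAt (fun w => phi (b * w)) z = meromorphicOrderAt phi (b * z) := by
  have hd : deriv (fun w : ℂ => b * w) z = b := by simp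
  exact meromorphicOrderAt_comp_of_deriv_ne_zero (f := phi) (g := fun w : ℂ => b * w)
    (by fun_prop) (by rw [hd]; exact hb)

theorem meromorphicAt_phi_comp_add (z c : ℂ) : MeromorphicAt (fun w => phi (w + c)) z :=
  (meromorphicAt_phi (z + c)).comp_analyticAt (g := fun w => w + c) (by fun_prop)

theorem meromorphicOrderAt_prod_phi {β : GaussianInt} (hβ : IsNormalized β)
    [Fintype (GaussianInt ⧸ Ideal.span {β})] (z : ℂ) :
    meromorphicOrderAt (fun w => ∏ c, phi (w + divisionPoint β c)) z =
      meromorphicOrderAt (fun w => phi (β * w)) z := by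
  classical
  rw [meromorphicOrderAt_phi_comp_const_mul (toComplex_ne_zero hβ.1.ne_zero),
    meromorphicOrderAt_phi, ← sum_isZero_add_divisionPoint hβ.1, ← sum_isPole_add_divisionPoint hβ,
    ← Finset.sum_sub_distrib, WithTop.coe_sum]
  rw [meromorphicOrderAt_fun_prod fun c _ => meromorphicAt_phi_comp_add z _]
  refine Finset.sum_congr rfl fun c _ => ?_
  rw [← meromorphicOrderAt_phi]
  exact meromorphicOrderAt_comp_add_const_eq_meromorphicOrderAt (f := phi)

/-- Because `2 = (1 + i)(1 - i)`, the period lattice contains the square lattice `2ϖ ℤ[i]`, whose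
axis-parallel periods suit the Liouville argument. -/
theorem phi_add_gaussian_mul_two_varpi (z : ℂ) (g : GaussianInt) :
    phi (z + (g : ℂ) * (2 * varpi)) = phi z := by
  rw [← phi_add_lattice z (g * ⟨1, -1⟩)]
  congr 2
  rw [map_mul, ← toComplex_two, two_eq, map_mul]
  ring

/-- The quotient of the two sides has order 0 everywhere and periods `2ϖ`, `2ϖ i`. Equality is
stated on punctured neighbourhoods because values at poles are conventional. -/
theorem exists_phi_mul_eq_const_mul_prod {β : GaussianInt} (hβ : IsNormalized β)
    [Fintype (GaussianInt ⧸ Ideal.span {β})] :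
    ∃ κ : ℂ, ∀ z : ℂ, (fun w : ℂ => phi (β * w)) =ᶠ[𝓝[≠] z]
      fun w => κ * ∏ c, phi (w + divisionPoint β c) := by
  have hb := toComplex_ne_zero hβ.1.ne_zero
  have hm1 := meromorphicAt_phi_comp_const_mul (β : ℂ)
  have hm2 : ∀ z, MeromorphicAt (fun w => ∏ c, phi (w + divisionPoint β c)) z := fun z =>
    MeromorphicAt.fun_prod fun c _ => meromorphicAt_phi_comp_add z _
  have htop : ∀ z, meromorphicOrderAt (fun w => ∏ c, phi (w + divisionPoint β c)) z ≠ ⊤ := by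
    classical
    intro z
    rw [meromorphicOrderAt_prod_phi hβ, meromorphicOrderAt_phi_comp_const_mul hb,
      meromorphicOrderAt_phi]
    exact WithTop.coe_ne_top
  have hper : ∀ (z : ℂ) (g : GaussianInt),
      phi (β * (z + g * (2 * varpi))) / ∏ c, phi (z + g * (2 * varpi) + divisionPoint β c) =
        phi (β * z) / ∏ c, phi (z + divisionPoint β c) := by
    intro z g
    simp only [add_right_comm z (_ * (2 * _)), phi_add_gaussian_mul_two_varpi]
    rw [mul_add, ← mul_assoc, ← map_mul, phi_add_gaussian_mul_two_varpi]
  have hord : ∀ z, 0 ≤ meromorphicOrderAt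
      (fun w => phi (β * w) / ∏ c, phi (w + divisionPoint β c)) z := by
    intro z
    refine le_of_le_of_eq ?_ (meromorphicOrderAt_div (hm1 z) (hm2 z)).symm
    rw [← meromorphicOrderAt_prod_phi hβ]
    have := htop z
    lift meromorphicOrderAt (fun w => ∏ c, phi (w + divisionPoint β c)) z to ℤ using this with n
    rw [← WithTop.LinearOrderedAddCommGroup.coe_sub, sub_self]
    rfl
  have hI : ((⟨0, 1⟩ : GaussianInt) : ℂ) = Complex.I := by simp [GaussianInt.toComplex_def]
  obtain ⟨κ, hκ⟩ := exists_eventuallyEq_const_of_periodic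
    (fun z => (hm1 z).fun_div (hm2 z)) hord (ω := 2 * varpi) (by linarith [varpi_pos])
    (fun z => by simpa using hper z 1)
    (fun z => by
      have h := hper z ⟨0, 1⟩
      rw [hI] at h
      rw [mul_comm ((2 * varpi : ℝ) : ℂ)]
      push_cast
      exact h)
  refine ⟨κ, fun z => ?_⟩
  filter_upwards [hκ z, (meromorphicOrderAt_ne_top_iff_eventually_ne_zero (hm2 z)).1 (htop z)]
    with w h1 h2
  rwa [div_eq_iff h2] at h1

/-! ### The constant is 1; the product of the nonzero division values -/

/-- Multiplication by `ι` splits `S` into orbits `{c, ι c, -c, -ι c}` of exactly four elements, each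
contributing `(h c * h (ι c))² = 1`. The induction removes one orbit at a time. -/
theorem prod_eq_one_of_mul_eq_one {A : Type*} [CommRing A] [DecidableEq A] {ι : A}
    (hι : ι * ι = -1) (h2 : ∀ c : A, c = -c → c = 0) {h : A → ℂ} (hneg : ∀ c, h (-c) = h c)
    (S : Finset A) (hS : ∀ c ∈ S, ι * c ∈ S) (h0 : 0 ∉ S) (hm : ∀ c ∈ S, h c * h (ι * c) = 1) :
    ∏ c ∈ S, h c = 1 := by
  induction hn : S.card using Nat.strong_induction_on generalizing S with
  | _ n ih =>
    rcases S.eq_empty_or_nonempty with rfl | ⟨c, hc⟩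
    · simp
    have hii : ∀ x : A, ι * (ι * x) = -x := fun x => by rw [← mul_assoc, hι]; ring
    have hc0 : c ≠ 0 := fun e => h0 (e ▸ hc)
    have n1 : c ≠ -c := fun e => hc0 (h2 c e)
    have n2 : c ≠ ι * c := fun e => n1 (by
      have := hii c
      rwa [← e, ← e] at this)
    have n3 : c ≠ -(ι * c) := fun e => n2 (by
      have := congrArg (ι * ·) e
      simp only [mul_neg, hii, neg_neg] at this
      exact this.symm)
    have hic := hS c hc
    have hnc : -c ∈ S := by rw [← hii]; exact hS _ hic
    have hnic : -(ι * c) ∈ S := by rw [← mul_neg]; exact hS _ hnc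
    set T : Finset A := {c, ι * c, -c, -(ι * c)} with hT
    have hTS : T ⊆ S := by
      intro x hx
      simp only [hT, Finset.mem_insert, Finset.mem_singleton] at hx
      rcases hx with rfl | rfl | rfl | rfl <;> assumption
    have hinj : ∀ x y : A, ι * x = ι * y → x = y := by
      intro x y hxy
      have := congrArg (fun t => -(ι * t)) hxy
      simpa [hii] using this
    have hprodT : ∏ x ∈ T, h x = 1 := by
      have n4 : ι * c ≠ -c := fun e => n3 (by rw [e, neg_neg])
      rw [hT, Finset.prod_insert, Finset.prod_insert, Finset.prod_insert, Finset.prod_singleton,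
        hneg, hneg]
      · linear_combination (h c * h (ι * c) + 1) * hm c hc
      · simp only [Finset.mem_singleton, neg_inj]; exact n2
      · simp only [Finset.mem_insert, Finset.mem_singleton]; rintro (e | e)
        · exact n4 e
        · exact n1 (hinj _ _ (by rw [mul_neg]; exact e))
      · simp only [Finset.mem_insert, Finset.mem_singleton]; rintro (e | e | e)
        exacts [n2 e, n1 e, n3 e]
    rw [← Finset.prod_sdiff hTS, hprodT, mul_one]
    refine ih (S \ T).card ?_ (S \ T) ?_ (fun h => h0 (Finset.sdiff_subset h))
      (fun x hx => hm x (Finset.sdiff_subset hx)) rfl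
    · rw [← hn]
      exact Finset.card_lt_card (Finset.sdiff_ssubset hTS ⟨c, by simp [hT]⟩)
    · intro x hx
      rw [Finset.mem_sdiff] at hx ⊢
      refine ⟨hS x hx.1, fun hxT => hx.2 ?_⟩
      simp only [hT, Finset.mem_insert, Finset.mem_singleton] at hxT ⊢
      rcases hxT with e | e | e | e
      · right; right; right
        rw [← e, hii, neg_neg]
      · left; exact hinj _ _ e
      · right; left
        apply hinj; rw [e, hii]
      · right; right; left
        apply hinj; rw [e, mul_neg]

theorem not_isPole_delta {β : GaussianInt} (hβ : IsOdd β) (α : GaussianInt) :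
    ¬ IsPole ((α : ℂ) * delta β) := by
  rw [← isZero_add_polePoint]
  have h := not_isZero_add_half hβ α (h := onePlusI) (not_two_dvd (by decide))
  rwa [onePlusI_toComplex] at h

theorem not_isPole_half_add_delta {β : GaussianInt} (hβ : IsOdd β) (α : GaussianInt) :
    ¬ IsPole (varpi / 2 + (α : ℂ) * delta β) := by
  rw [← isZero_add_polePoint]
  -- `(2 + i) ϖ / 2 = ϖ / 2 + polePoint`.
  have h := not_isZero_add_half hβ α (h := ⟨2, 1⟩) (not_two_dvd (by decide))
  have e : ((⟨2, 1⟩ : GaussianInt) : ℂ) = 2 + Complex.I := by simp [GaussianInt.toComplex_def]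
  rw [e] at h
  convert! h using 2
  unfold polePoint
  ring

theorem not_isPole_mul {β : GaussianInt} (hβ : IsNormalized β)
    [Fintype (GaussianInt ⧸ Ideal.span {β})] {z : ℂ} (hz : ∀ c, ¬ IsPole (z + divisionPoint β c)) :
    ¬ IsPole (β * z) := by
  classical
  intro h
  have := sum_isPole_add_divisionPoint hβ z
  simp [hz, h] at this

theorem continuousAt_phi {z : ℂ} (hz : ¬ IsPole z) : ContinuousAt phi z :=
  (hasDerivAt_phi hz).continuousAt

/-- The class 0 gives `φ(ϖ/2) = 1`. The others cancel in orbits under `i`, since the lemniscate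
cosine is even and takes inverse values at `s` and `i s`. -/
theorem prod_phi_half_add_divisionPoint {β : GaussianInt} (hβ : IsOdd β)
    [Fintype (GaussianInt ⧸ Ideal.span {β})] :
    ∏ c, phi (varpi / 2 + divisionPoint β c) = 1 := by
  classical
  have h0 := hβ.ne_zero
  have hI : ((⟨0, 1⟩ : GaussianInt) : ℂ) = Complex.I := by simp [GaussianInt.toComplex_def]
  set ι : GaussianInt ⧸ Ideal.span {β} := Ideal.Quotient.mk _ ⟨0, 1⟩ with hι
  have e0 : phi (varpi / 2 + divisionPoint β 0) = 1 := by
    have := phi_add_divisionPoint h0 0 (varpi / 2)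
    simpa [phi_varpi_half] using this
  rw [← Finset.mul_prod_erase _ _ (Finset.mem_univ 0), e0, one_mul]
  refine prod_eq_one_of_mul_eq_one (ι := ι) ?_ ?_ (fun c => ?_) _ ?_ (by simp) (fun c _ => ?_)
  · rw [hι, ← map_mul, ← map_one (Ideal.Quotient.mk (Ideal.span {β})), ← map_neg]
    congr 1
  · intro c hc
    have h2 := isUnit_mk.2 hβ.isCoprime_two.symm
    rw [eq_neg_iff_add_eq_zero, ← two_mul] at hc
    rw [map_ofNat] at h2
    exact h2.mul_right_eq_zero.1 hc
  · conv_lhs => rw [← mk_out c, ← map_neg, phi_add_divisionPoint h0, map_neg, neg_mul,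
      ← sub_eq_add_neg, phi_half_sub]
    rfl
  · intro c hc
    simp only [Finset.mem_erase, Finset.mem_univ, and_true] at hc ⊢
    intro h
    apply hc
    have : ι * (ι * c) = 0 := by rw [h, mul_zero]
    have e : ι * ι = -1 := by
      rw [hι, ← map_mul, ← map_one (Ideal.Quotient.mk (Ideal.span {β})), ← map_neg]
      congr 1
    rw [← mul_assoc, e] at this
    simpa using this
  · have e : phi (varpi / 2 + divisionPoint β (ι * c)) =
        phi (varpi / 2 + Complex.I * divisionPoint β c) := by
      conv_lhs => rw [← mk_out c, hι, ← map_mul, phi_add_divisionPoint h0, map_mul, hI, mul_assoc]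
      rfl
    rw [e]
    apply phi_half_add_mul_phi_half_add_I_mul
    · rw [← realPhi_add_half_eq_zero_iff]
      intro h
      apply not_isZero_add_half hβ (Quotient.out c) (h := ⟨0, 1⟩) (not_two_dvd (by decide))
      rw [hI]
      refine ⟨?_, ?_⟩
      · convert! h.1 using 2
        simp [divisionPoint]
      · convert! h.2 using 2
        simp [divisionPoint]
    · rw [← realPhi_add_half_eq_zero_iff]
      intro h
      apply not_isZero_add_half hβ (Quotient.out c) (h := 1) (not_two_dvd (by decide))
      rw [map_one]
      refine ⟨?_, ?_⟩
      · convert! h.2 using 2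
        simp [divisionPoint]
      · convert! h.1 using 2
        simp [divisionPoint]

/-- The multiplication formula `φ(β z) = ∏ φ(z + α δ_β)` for normalized `β`. -/
theorem phi_mul_eq_prod {β : GaussianInt} (hβ : IsNormalized β)
    [Fintype (GaussianInt ⧸ Ideal.span {β})] {z : ℂ} (hz : ∀ c, ¬ IsPole (z + divisionPoint β c)) :
    phi (β * z) = ∏ c, phi (z + divisionPoint β c) := by
  obtain ⟨κ, hκ⟩ := exists_phi_mul_eq_const_mul_prod hβ
  have key : ∀ z : ℂ, (∀ c, ¬ IsPole (z + divisionPoint β c)) →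
      phi (β * z) = κ * ∏ c, phi (z + divisionPoint β c) := by
    intro z hz
    refine eq_of_eventuallyEq_nhdsNE (f := fun w => phi (β * w))
      (g := fun w => κ * ∏ c, phi (w + divisionPoint β c)) ?_ ?_ (hκ z)
    · exact (continuousAt_phi (not_isPole_mul hβ hz)).comp' (by fun_prop)
    · refine continuousAt_const.mul (tendsto_finsetProd _ fun c _ => ?_)
      exact (continuousAt_phi (hz c)).comp' (f := fun w => w + divisionPoint β c) (by fun_prop)
  -- Evaluation at `ϖ/2`: by normalization `β ϖ/2` differs from `ϖ/2` by a period, so both `φ(β z)`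
  -- and the product equal 1.
  have hκ1 : κ = 1 := by
    have h := key (varpi / 2) (fun c => not_isPole_half_add_delta hβ.1 _)
    rw [prod_phi_half_add_divisionPoint hβ.1, mul_one] at h
    obtain ⟨g, hg⟩ := hβ.2
    have hg' := congrArg GaussianInt.toComplex hg
    simp only [map_sub, map_mul, map_one, toComplex_two] at hg'
    have e : (β : ℂ) * (varpi / 2) = varpi / 2 + g * (onePlusI * varpi) := by
      linear_combination (varpi / 2 : ℂ) * hg'
    rw [← h, e, phi_add_lattice, phi_varpi_half]
  rw [key z hz, hκ1, one_mul]

theorem divisionPoint_zero_congr {β : GaussianInt} (hβ : β ≠ 0) (z : ℂ) :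
    phi (z + divisionPoint β 0) = phi z := by
  simpa using phi_add_divisionPoint hβ 0 z

open Classical in
-- Differentiate the product formula at 0: the left side gives `β φ'(0) = β`, and on the right only
-- the factor of the class 0 vanishes, so the product of the others remains.
theorem prod_phi_divisionPoint {β : GaussianInt} (hβ : IsNormalized β)
    [Fintype (GaussianInt ⧸ Ideal.span {β})] :
    ∏ c ∈ Finset.univ.erase 0, phi (divisionPoint β c) = β := by
  have h0 := hβ.1.ne_zero
  have hp0 : ¬ IsPole 0 := by simpa using not_isPole_delta hβ.1 0
  have hnp : ∀ c, ¬ IsPole (0 + divisionPoint β c) := fun c => by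
    rw [zero_add]; exact not_isPole_delta hβ.1 _
  have hev : (fun z : ℂ => phi (β * z)) =ᶠ[𝓝 0]
      fun z => phi z * ∏ c ∈ Finset.univ.erase 0, phi (z + divisionPoint β c) := by
    have hopen : ∀ c, ∀ᶠ z in 𝓝 (0 : ℂ), ¬ IsPole (z + divisionPoint β c) := fun c =>
      (by fun_prop : Continuous fun z : ℂ => z + divisionPoint β c).continuousAt.eventually_mem
        (isOpen_not_isPole.mem_nhds (hnp c))
    filter_upwards [eventually_all.2 hopen] with z hz
    rw [phi_mul_eq_prod hβ hz, ← Finset.mul_prod_erase _ _ (Finset.mem_univ 0),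
      divisionPoint_zero_congr h0]
  have hl : HasDerivAt (fun z : ℂ => phi (β * z)) (β : ℂ) 0 := by
    have h1 : HasDerivAt phi 1 ((β : ℂ) * 0) := by
      rw [mul_zero, ← phiDeriv_zero]
      exact hasDerivAt_phi hp0
    have h2 : HasDerivAt (fun z : ℂ => (β : ℂ) * z) β 0 := by
      simpa using (hasDerivAt_id (0 : ℂ)).const_mul (β : ℂ)
    have h3 := h1.comp (0 : ℂ) h2
    rw [one_mul] at h3
    exact h3
  have hd : DifferentiableAt ℂ
      (fun z => ∏ c ∈ Finset.univ.erase 0, phi (z + divisionPoint β c)) 0 := by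
    refine DifferentiableAt.fun_finsetProd fun c _ => ?_
    exact (hasDerivAt_phi (hnp c)).differentiableAt.comp (0 : ℂ)
      (f := fun z => z + divisionPoint β c) (by fun_prop)
  have hr := (hasDerivAt_phi hp0).mul hd.hasDerivAt
  have := (hr.congr_of_eventuallyEq hev).unique hl
  rw [phiDeriv_zero, phi_zero, zero_mul, add_zero, one_mul] at this
  simpa using this

/-! ### Products over residue systems -/

theorem dvd_out_sub {β α : GaussianInt} :
    β ∣ Quotient.out (Ideal.Quotient.mk (Ideal.span {β}) α) - α := by
  have h := mk_out (Ideal.Quotient.mk (Ideal.span {β}) α)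
  rwa [Ideal.Quotient.eq, Ideal.mem_span_singleton] at h

theorem eq_of_dvd_out_sub_out {β : GaussianInt} {c d : GaussianInt ⧸ Ideal.span {β}}
    (h : β ∣ (Quotient.out c : GaussianInt) - Quotient.out d) : c = d := by
  rwa [← Ideal.mem_span_singleton, ← Ideal.Quotient.eq, mk_out, mk_out] at h

/-- A product over a complete residue system does not depend on the system. -/
theorem prod_residues {β : GaussianInt} [Fintype (GaussianInt ⧸ Ideal.span {β})]
    {F : GaussianInt → ℂ} (hF : ∀ α α', β ∣ α - α' → F α = F α') {ι : Type*} [Fintype ι]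
    {r : ι → GaussianInt} (hinj : ∀ i j, β ∣ r i - r j → i = j) (hsurj : ∀ α, ∃ i, β ∣ r i - α) :
    ∏ i, F (r i) = ∏ c : GaussianInt ⧸ Ideal.span {β}, F (Quotient.out c) := by
  refine Fintype.prod_bijective (fun i => Ideal.Quotient.mk (Ideal.span {β}) (r i)) ⟨?_, ?_⟩ _ _ ?_
  · intro i j h
    exact hinj i j (by rwa [Ideal.Quotient.eq, Ideal.mem_span_singleton] at h)
  · intro c
    obtain ⟨α, rfl⟩ := Ideal.Quotient.mk_surjective c
    obtain ⟨i, hi⟩ := hsurj α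
    exact ⟨i, by rwa [Ideal.Quotient.eq, Ideal.mem_span_singleton]⟩
  · intro i
    exact (hF _ _ dvd_out_sub).symm

/-- Division with remainder by `γ`: every class mod `π γ` is uniquely `b + γ c` with `b` mod `γ` and
`c` mod `π`. -/
theorem prod_residues_mul {β π γ : GaussianInt} (hβ : β = π * γ) (hγ : γ ≠ 0)
    [Fintype (GaussianInt ⧸ Ideal.span {π})] [Fintype (GaussianInt ⧸ Ideal.span {γ})]
    [Fintype (GaussianInt ⧸ Ideal.span {β})]
    {F : GaussianInt → ℂ} (hF : ∀ α α', β ∣ α - α' → F α = F α') :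
    ∏ a : GaussianInt ⧸ Ideal.span {β}, F (Quotient.out a) =
      ∏ b : GaussianInt ⧸ Ideal.span {γ}, ∏ c : GaussianInt ⧸ Ideal.span {π},
        F (Quotient.out b + γ * Quotient.out c) := by
  subst hβ
  rw [← Fintype.prod_prod_type', ← prod_residues hF (ι := (GaussianInt ⧸ Ideal.span {γ}) ×
    (GaussianInt ⧸ Ideal.span {π})) (r := fun p => Quotient.out p.1 + γ * Quotient.out p.2)]
  · rintro ⟨b, c⟩ ⟨b', c'⟩ h
    simp only at h
    have hb : b = b' := by
      apply eq_of_dvd_out_sub_out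
      have h1 := (Dvd.intro_left π rfl).trans h
      rw [show (Quotient.out b : GaussianInt) + γ * Quotient.out c
        - (Quotient.out b' + γ * Quotient.out c') = (Quotient.out b - Quotient.out b')
          + γ * (Quotient.out c - Quotient.out c') by ring] at h1
      exact (dvd_add_left (Dvd.intro _ rfl)).1 h1
    subst hb
    rw [add_sub_add_left_eq_sub, ← mul_sub, mul_comm π] at h
    rw [eq_of_dvd_out_sub_out ((mul_dvd_mul_iff_left hγ).1 h)]
  · intro α
    obtain ⟨t, ht⟩ := dvd_out_sub (β := γ) (α := α)
    obtain ⟨s, hs⟩ := dvd_out_sub (β := π) (α := -t)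
    refine ⟨(Ideal.Quotient.mk _ α, Ideal.Quotient.mk _ (-t)), s, ?_⟩
    linear_combination ht + γ * hs

theorem isCoprime_congr {γ α α' : GaussianInt} (h : γ ∣ α - α') : IsCoprime α γ ↔ IsCoprime α' γ := by
  obtain ⟨t, ht⟩ := h
  rw [sub_eq_iff_eq_add'.1 ht]
  exact IsCoprime.add_mul_left_left_iff

theorem phi_delta_congr {β : GaussianInt} (hβ : β ≠ 0) {α α' : GaussianInt} (h : β ∣ α - α') :
    phi ((α : ℂ) * delta β) = phi ((α' : ℂ) * delta β) := by
  simpa using phi_add_delta_congr hβ h 0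

theorem delta_mul (π γ : GaussianInt) (hπ : π ≠ 0) : (π : ℂ) * delta (π * γ) = delta γ := by
  have := toComplex_ne_zero hπ
  unfold delta
  rw [map_mul, ← mul_div_assoc, mul_div_mul_left _ _ this]

/-! ### Unit products and the distribution relation -/

open Classical in
/-- The product of the division values `φ(α δ_β)` over the units `α` modulo `β`. -/
noncomputable def unitProd (β : GaussianInt) : ℂ :=
  ∏ᶠ c : GaussianInt ⧸ Ideal.span {β},
    if IsCoprime (Quotient.out c) β then phi ((Quotient.out c : GaussianInt) * delta β) else 1

open Classical in
theorem unitProd_eq_prod (β : GaussianInt) [Fintype (GaussianInt ⧸ Ideal.span {β})] :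
    unitProd β = ∏ c : GaussianInt ⧸ Ideal.span {β},
      if IsCoprime (Quotient.out c) β then phi ((Quotient.out c : GaussianInt) * delta β) else 1 :=
  finprod_eq_prod_of_fintype _

/-- Each factor at 0 is `-φ(α δ_β) = φ(-α δ_β)`, and `α ↦ -α` permutes the units, so no sign
survives. -/
theorem lemnatomic_eval_zero {β : GaussianInt} (hβ : β ≠ 0) :
    (lemnatomic β).eval 0 = unitProd β := by
  classical
  have := finite_quotient hβ
  have := Fintype.ofFinite (GaussianInt ⧸ Ideal.span {β})
  have hneg : ∀ a : (GaussianInt ⧸ Ideal.span {β})ˣ,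
      -divisionValue β a = divisionValue β ((-a : Units _) : _ ⧸ Ideal.span {β}) := by
    intro a
    obtain ⟨α, hα⟩ := Ideal.Quotient.mk_surjective (a : GaussianInt ⧸ Ideal.span {β})
    rw [Units.val_neg, ← hα, ← map_neg, divisionValue_mk hβ, divisionValue_mk hβ, map_neg, neg_mul,
      phi_neg]
  rw [lemnatomic, finprod_eq_prod_of_fintype, Polynomial.eval_prod, unitProd_eq_prod]
  simp only [Polynomial.eval_sub, Polynomial.eval_X, Polynomial.eval_C, zero_sub, hneg]
  rw [Fintype.prod_equiv (Equiv.neg (GaussianInt ⧸ Ideal.span {β})ˣ)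
    (fun a => divisionValue β ((-a : Units _) : GaussianInt ⧸ Ideal.span {β}))
    (fun a => divisionValue β (a : GaussianInt ⧸ Ideal.span {β})) fun _ => rfl, ← Finset.prod_filter]
  symm
  refine Finset.prod_bij' (fun c hc => (isUnit_mk.2 (Finset.mem_filter.1 hc).2).unit)
    (fun a _ => (a : GaussianInt ⧸ Ideal.span {β})) (fun _ _ => Finset.mem_univ _) ?_ ?_ ?_ ?_
  · intro a _
    rw [Finset.mem_filter, ← isUnit_mk, mk_out]
    exact ⟨Finset.mem_univ _, a.isUnit⟩
  · intro c hc
    simp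
  · intro a _
    ext
    simp
  · intro c hc
    simp [divisionValue]

/-- Multiplying representatives by `u` permutes the unit classes, and `u α δ_{uγ} = α δ_γ`. -/
theorem unitProd_unit_mul {u γ : GaussianInt} (hu : IsUnit u) (hγ : γ ≠ 0) :
    unitProd (u * γ) = unitProd γ := by
  classical
  have := finite_quotient hγ
  have hu0 := hu.ne_zero
  have := finite_quotient (mul_ne_zero hu0 hγ)
  have := Fintype.ofFinite (GaussianInt ⧸ Ideal.span {γ})
  have := Fintype.ofFinite (GaussianInt ⧸ Ideal.span {u * γ})
  rw [unitProd_eq_prod, unitProd_eq_prod, ← prod_residues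
    (F := fun α => if IsCoprime α (u * γ) then phi (α * delta (u * γ)) else 1) (ι := GaussianInt ⧸ Ideal.span {γ})
    (r := fun c => u * Quotient.out c)]
  · refine Finset.prod_congr rfl fun c _ => ?_
    have e : IsCoprime (u * Quotient.out c) (u * γ) ↔ IsCoprime (Quotient.out c) γ := by
      rw [isCoprime_mul_unit_left_left hu, isCoprime_mul_unit_left_right hu]
    simp only [e]
    rw [map_mul, mul_right_comm, delta_mul _ _ hu0, mul_comm]
  · intro α α' h
    simp only [isCoprime_congr h, phi_delta_congr (mul_ne_zero hu0 hγ) h]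
  · intro c d h
    rw [← mul_sub] at h
    exact eq_of_dvd_out_sub_out ((mul_dvd_mul_iff_left hu0).1 h)
  · intro α
    obtain ⟨v, hv⟩ := hu.exists_right_inv
    obtain ⟨t, ht⟩ := dvd_out_sub (β := γ) (α := v * α)
    exact ⟨Ideal.Quotient.mk _ (v * α), t, by linear_combination u * ht + α * hv⟩

open Classical in
/-- The distribution relation for division values modulo `p γ`. -/
theorem prod_isCoprime_phi_delta_mul {p γ : GaussianInt} (hp : IsNormalized p) (hγ : IsOdd γ)
    [Fintype (GaussianInt ⧸ Ideal.span {p * γ})] :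
    ∏ a : GaussianInt ⧸ Ideal.span {p * γ},
      (if IsCoprime (Quotient.out a) γ then
        phi ((Quotient.out a : GaussianInt) * delta (p * γ)) else 1) = unitProd γ := by
  have hp0 := hp.1.ne_zero
  have hγ0 := hγ.ne_zero
  have hodd : IsOdd (p * γ) := IsCoprime.mul_left hp.1 hγ
  have := finite_quotient hγ0
  have := finite_quotient hp0
  have := Fintype.ofFinite (GaussianInt ⧸ Ideal.span {γ})
  have := Fintype.ofFinite (GaussianInt ⧸ Ideal.span {p})
  rw [prod_residues_mul (π := p) rfl hγ0 (F := fun α => if IsCoprime α γ then phi (α * delta (p * γ)) else 1),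
    unitProd_eq_prod]
  · refine Finset.prod_congr rfl fun b _ => ?_
    simp only [IsCoprime.add_mul_left_left_iff]
    split_ifs with h
    · have e : ∀ c : GaussianInt ⧸ Ideal.span {p},
          ((Quotient.out b + γ * Quotient.out c : GaussianInt) : ℂ) * delta (p * γ) =
            (Quotient.out b : GaussianInt) * delta (p * γ) + divisionPoint p c := by
        intro c
        have := delta_mul γ p hγ0
        rw [mul_comm γ p] at this
        rw [divisionPoint, ← this, map_add, map_mul]
        ring
      simp only [e]
      rw [← phi_mul_eq_prod hp, mul_left_comm, delta_mul _ _ hp0]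
      intro c
      rw [← e]
      exact not_isPole_delta hodd _
    · simp
  · intro α α' h
    simp only [isCoprime_congr ((Dvd.intro_left p rfl).trans h),
      phi_delta_congr (mul_ne_zero hp0 hγ0) h]

/-- When `p ∣ γ`, being coprime to `p γ` and to `γ` are the same, so this is the distribution
relation itself. -/
theorem unitProd_mul_of_dvd {p γ : GaussianInt} (hp : IsNormalized p) (hγ : IsOdd γ) (h : p ∣ γ) :
    unitProd (p * γ) = unitProd γ := by
  classical
  have := finite_quotient (mul_ne_zero hp.1.ne_zero hγ.ne_zero)
  have := Fintype.ofFinite (GaussianInt ⧸ Ideal.span {p * γ})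
  rw [← prod_isCoprime_phi_delta_mul hp hγ, unitProd_eq_prod]
  refine Finset.prod_congr rfl fun a _ => ?_
  have : IsCoprime (Quotient.out a) (p * γ) ↔ IsCoprime (Quotient.out a) γ := by
    rw [IsCoprime.mul_right_iff]
    exact ⟨fun h => h.2, fun h' => ⟨h'.of_isCoprime_of_dvd_right h, h'⟩⟩
  simp only [this]

theorem phi_delta_ne_zero {γ α : GaussianInt} (hγ : IsOdd γ) (h : ¬ γ ∣ α) :
    phi (α * delta γ) ≠ 0 := by
  rw [Ne, phi_eq_zero_iff (not_isPole_delta hγ α), isZero_iff]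
  rintro ⟨g, hg⟩
  have hb := toComplex_ne_zero hγ.ne_zero
  have hv : (varpi : ℂ) ≠ 0 := by exact_mod_cast varpi_pos.ne'
  have e : α * onePlusI = γ * g := by
    apply GaussianInt.toComplex_injective
    simp only [map_mul]
    unfold delta at hg
    field_simp at hg
    linear_combination hg
  exact h (IsCoprime.dvd_of_dvd_mul_right hγ (Dvd.intro _ e.symm))

theorem unitProd_ne_zero {γ : GaussianInt} (hγ : IsOdd γ) (hu : ¬ IsUnit γ) : unitProd γ ≠ 0 := by
  classical
  have := finite_quotient hγ.ne_zero
  have := Fintype.ofFinite (GaussianInt ⧸ Ideal.span {γ})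
  rw [unitProd_eq_prod, Finset.prod_ne_zero_iff]
  intro c _
  split_ifs with h
  · exact phi_delta_ne_zero hγ fun hd => hu (h.symm.isUnit_of_dvd hd)
  · exact one_ne_zero

/-- The distribution product over `α` coprime to `γ` splits by whether `p ∣ α`. The part prime to
`p` is `unitProd (p * γ)`; the multiples of `p` give `unitProd γ`, the value of the whole. For
nonunit `γ` it is nonzero and cancels. -/
theorem unitProd_mul_of_not_dvd {p γ : GaussianInt} (hp : IsNormalized p) (hprime : Prime p)
    (hγ : IsOdd γ) (hu : ¬ IsUnit γ) (h : ¬ p ∣ γ) : unitProd (p * γ) = 1 := by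
  classical
  have hp0 := hp.1.ne_zero
  have hγ0 := hγ.ne_zero
  have := finite_quotient (mul_ne_zero hp0 hγ0)
  have := finite_quotient (mul_ne_zero hγ0 hp0)
  have := finite_quotient hγ0
  have := finite_quotient hp0
  have := Fintype.ofFinite (GaussianInt ⧸ Ideal.span {p * γ})
  have := Fintype.ofFinite (GaussianInt ⧸ Ideal.span {γ})
  have := Fintype.ofFinite (GaussianInt ⧸ Ideal.span {p})
  have hpγ : IsCoprime p γ := hprime.irreducible.coprime_iff_not_dvd.2 h
  have hcop : ∀ α : GaussianInt, IsCoprime α p ↔ ¬ p ∣ α := fun α => by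
    rw [isCoprime_comm]; exact hprime.irreducible.coprime_iff_not_dvd
  have hdivisible : ∏ a : GaussianInt ⧸ Ideal.span {p * γ},
      (if p ∣ Quotient.out a ∧ IsCoprime (Quotient.out a) γ then
        phi ((Quotient.out a : GaussianInt) * delta (p * γ)) else 1) = unitProd γ := by
    -- Here the roles are exchanged: classes are `b + p c` with `b` mod `p`, and only `b = 0` is
    -- divisible by `p`.
    rw [prod_residues_mul (mul_comm p γ) hp0 (F := fun α => if p ∣ α ∧ IsCoprime α γ then
      phi (α * delta (p * γ)) else 1), Fintype.prod_eq_single 0]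
    -- The chosen representative of 0 is some `p t`, not necessarily 0, hence the shifted residue
    -- system `t + b` mod `γ`.
    · obtain ⟨t, ht⟩ : p ∣ Quotient.out (0 : GaussianInt ⧸ Ideal.span {p}) := by
        simpa using dvd_out_sub (β := p) (α := 0)
      rw [unitProd_eq_prod, ← prod_residues (ι := GaussianInt ⧸ Ideal.span {γ})
        (F := fun α => if IsCoprime α γ then phi (α * delta γ) else 1)
        (r := fun b => t + Quotient.out b)]
      · refine Finset.prod_congr rfl fun b _ => ?_
        rw [ht, ← mul_add]
        simp only [dvd_mul_right, true_and, IsCoprime.mul_left_iff, hpγ]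
        rw [map_mul, mul_right_comm, delta_mul _ _ hp0, mul_comm]
      · intro α α' h
        simp only [isCoprime_congr h, phi_delta_congr hγ0 h]
      · intro b c hbc
        rw [add_sub_add_left_eq_sub] at hbc
        exact eq_of_dvd_out_sub_out hbc
      · intro α
        obtain ⟨s, hs⟩ := dvd_out_sub (β := γ) (α := α - t)
        exact ⟨Ideal.Quotient.mk _ (α - t), s, by linear_combination hs⟩
    · intro c hc
      refine Finset.prod_eq_one fun b _ => if_neg fun h => hc ?_
      have h1 := (dvd_add_left (Dvd.intro _ rfl)).1 h.1
      rw [← mk_out c, Ideal.Quotient.eq_zero_iff_mem, Ideal.mem_span_singleton]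
      exact h1
    · intro α α' h
      simp only [isCoprime_congr ((Dvd.intro_left p rfl).trans h),
        phi_delta_congr (mul_ne_zero hp0 hγ0) h]
      have : p ∣ α ↔ p ∣ α' := by
        have := (Dvd.intro _ rfl).trans h
        exact ⟨fun h' => (dvd_sub_right h').1 this, fun h' => (dvd_sub_left h').1 this⟩
      simp only [this]
  have key := prod_isCoprime_phi_delta_mul hp hγ
  rw [← mul_left_inj' (unitProd_ne_zero hγ hu), one_mul]
  conv_lhs => rw [← hdivisible]
  conv_rhs => rw [← key]
  rw [unitProd_eq_prod, ← Finset.prod_mul_distrib]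
  refine Finset.prod_congr rfl fun a _ => ?_
  simp only [IsCoprime.mul_right_iff, hcop]
  by_cases h1 : p ∣ Quotient.out a <;> by_cases h2 : IsCoprime (Quotient.out a) γ <;> simp [h1, h2]

/-- Modulo a prime every nonzero class is a unit, so `prod_phi_divisionPoint` applies. -/
theorem unitProd_prime {p : GaussianInt} (hp : IsNormalized p) (hprime : Prime p) :
    unitProd p = p := by
  classical
  have := finite_quotient hp.1.ne_zero
  have := Fintype.ofFinite (GaussianInt ⧸ Ideal.span {p})
  rw [unitProd_eq_prod, ← prod_phi_divisionPoint hp, ← Finset.prod_filter]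
  refine Finset.prod_congr ?_ fun _ _ => rfl
  ext c
  rw [Finset.mem_filter, Finset.mem_erase, isCoprime_comm, hprime.irreducible.coprime_iff_not_dvd,
    ← Ideal.mem_span_singleton, ← Ideal.Quotient.eq_zero_iff_mem, mk_out]
  simp

/-! ### Prime powers, normalization and the final case distinction -/

theorem IsOdd.pow {p : GaussianInt} (hp : IsOdd p) (k : ℕ) : IsOdd (p ^ k) := IsCoprime.pow_left hp

theorem unitProd_prime_pow {p : GaussianInt} (hp : IsNormalized p) (hprime : Prime p) (k : ℕ) :
    unitProd (p ^ (k + 1)) = p := by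
  induction k with
  | zero => rw [zero_add, pow_one, unitProd_prime hp hprime]
  | succ k ih =>
    rw [pow_succ', unitProd_mul_of_dvd hp (hp.1.pow _) (dvd_pow_self p (Nat.succ_ne_zero k)), ih]

theorem unitProd_prime_pow_mul {p γ : GaussianInt} (hp : IsNormalized p) (hprime : Prime p)
    (hγ : IsOdd γ) (hu : ¬ IsUnit γ) (h : ¬ p ∣ γ) (k : ℕ) :
    unitProd (p ^ (k + 1) * γ) = 1 := by
  induction k with
  | zero => rw [zero_add, pow_one, unitProd_mul_of_not_dvd hp hprime hγ hu h]
  | succ k ih =>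
    rw [pow_succ', mul_assoc, unitProd_mul_of_dvd hp (IsCoprime.mul_left (hp.1.pow _) hγ)
      ((dvd_pow_self p (Nat.succ_ne_zero k)).mul_right _), ih]

theorem IsOdd.re_add_im_emod_two {p : GaussianInt} (hp : IsOdd p) : (p.re + p.im) % 2 = 1 := by
  by_contra hne
  refine not_isUnit_onePlusI (hp.symm.isUnit_of_dvd ⟨⟨(p.re + p.im) / 2, (p.im - p.re) / 2⟩, ?_⟩)
  apply Zsqrtd.ext <;> simp [onePlusI] <;> omega

theorem two_mul_onePlusI_dvd {q : GaussianInt} (h1 : (q.re - 1 + q.im) % 4 = 0)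
    (h2 : (q.im - q.re + 1) % 4 = 0) : 2 * onePlusI ∣ q - 1 := by
  have e : 2 * onePlusI = ⟨2, 2⟩ := by apply Zsqrtd.ext <;> simp [onePlusI]
  rw [e]
  -- The quotient `(q - 1) / (2 + 2i) = (q - 1)(1 - i) / 4`.
  refine ⟨⟨(q.re - 1 + q.im) / 4, (q.im - q.re + 1) / 4⟩, ?_⟩
  apply Zsqrtd.ext <;> simp <;> omega

/-- The units mod `2(1 + i)` are the classes of `±1, ±i`. The parity of `p.im` decides between real
and imaginary `u`, and a residue mod 4 fixes the sign. -/
theorem exists_isUnit_isNormalized {p : GaussianInt} (hp : IsOdd p) :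
    ∃ u : GaussianInt, IsUnit u ∧ IsNormalized (u * p) := by
  have hodd := hp.re_add_im_emod_two
  suffices h : ∃ u : GaussianInt, IsUnit u ∧ 2 * onePlusI ∣ u * p - 1 by
    obtain ⟨u, hu, hd⟩ := h
    exact ⟨u, hu, (isCoprime_mul_unit_left_left hu _ _).2 hp, hd⟩
  have hI : IsUnit (⟨0, 1⟩ : GaussianInt) := IsUnit.of_mul_eq_one ⟨0, -1⟩ (by decide)
  rcases Int.emod_two_eq_zero_or_one p.im with hi | hi
  · by_cases h4 : (p.re - 1 + p.im) % 4 = 0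
    · exact ⟨1, isUnit_one, two_mul_onePlusI_dvd (by simp; omega) (by simp; omega)⟩
    · exact ⟨-1, isUnit_one.neg, two_mul_onePlusI_dvd (by simp; omega) (by simp; omega)⟩
  · by_cases h4 : (-p.im - 1 + p.re) % 4 = 0
    · exact ⟨_, hI, two_mul_onePlusI_dvd (by simp; omega) (by simp; omega)⟩
    · exact ⟨_, hI.neg, two_mul_onePlusI_dvd (by simp; omega) (by simp; omega)⟩

theorem lemnatomic_eval_zero_cases (β : GaussianInt) (hodd : IsOdd β) (hunit : ¬ IsUnit β) :
    (∀ (u p : GaussianInt) (k : ℕ), IsUnit u → Prime p → IsNormalized p → 1 ≤ k →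
        β = u * p ^ k → (lemnatomic β).eval 0 = (p : ℂ)) ∧
    ((¬ ∃ (u p : GaussianInt) (k : ℕ), IsUnit u ∧ Prime p ∧ IsNormalized p ∧ 1 ≤ k ∧
        β = u * p ^ k) → (lemnatomic β).eval 0 = 1) := by
  have hβ0 := hodd.ne_zero
  rw [lemnatomic_eval_zero hβ0]
  constructor
  · rintro u p k hu hprime hp hk rfl
    obtain ⟨k, rfl⟩ := Nat.exists_eq_add_of_le' hk
    rw [unitProd_unit_mul hu (pow_ne_zero _ hprime.ne_zero), unitProd_prime_pow hp hprime]
  · intro hno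
    -- Split off the full power of one normalized prime factor; the cofactor `γ` cannot be a unit,
    -- since `β` would then have the excluded form.
    obtain ⟨q, hq, hqβ⟩ := WfDvdMonoid.exists_irreducible_factor hunit hβ0
    obtain ⟨u, hu, hn⟩ := exists_isUnit_isNormalized (IsCoprime.of_isCoprime_of_dvd_left hodd hqβ)
    have hprime : Prime (u * q) := (associated_unit_mul_left q u hu).symm.prime hq.prime
    have hdvd : u * q ∣ β := (associated_unit_mul_left q u hu).dvd.trans hqβ
    generalize u * q = p at hn hprime hdvd
    obtain ⟨γ, hβγ, hpγ⟩ :=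
      (FiniteMultiplicity.of_prime_left hprime hβ0).exists_eq_pow_mul_and_not_dvd
    generalize multiplicity p β = k at hβγ
    subst hβγ
    rcases k with _ | k
    · exact absurd (by simpa using hdvd) hpγ
    · refine unitProd_prime_pow_mul hn hprime
        (IsCoprime.of_isCoprime_of_dvd_left hodd (Dvd.intro_left _ rfl)) (fun hγ => ?_) hpγ k
      exact hno ⟨γ, p, k + 1, hγ, hprime, hn, by omega, mul_comm _ _⟩

end Lemnatomic

theorem proposition5p4 (β : GaussianInt) (hodd : Lemnatomic.IsOdd β) (hunit : ¬ IsUnit β) :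
    (∀ (u p : GaussianInt) (k : ℕ), IsUnit u → Prime p → Lemnatomic.IsNormalized p → 1 ≤ k →
        β = u * p ^ k → (Lemnatomic.lemnatomic β).eval 0 = (p : ℂ)) ∧
    ((¬ ∃ (u p : GaussianInt) (k : ℕ), IsUnit u ∧ Prime p ∧ Lemnatomic.IsNormalized p ∧ 1 ≤ k ∧
        β = u * p ^ k) → (Lemnatomic.lemnatomic β).eval 0 = 1) :=
  Lemnatomic.lemnatomic_eval_zero_cases β hodd hunit
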